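/- **Setting.** Let $d\ge 2$. A path $x:[0,1]\to\mathbb R^d$ has bounded variation if its total variation $\|x\|_{TV}=\sup\sum_i\|x_{t_i}-x_{t_{i-1}}\|$ (supremum over all finite subdivisions of $[0,1]$, Euclidean norm) is finite. Its signature coefficient along $I=(i_1,\dots,i_k)\in\{1,\dots,d\}^k$ is the iterated Stieltjes integral $$S^I(x)=\int\!\cdots\!\int_{0\le u_1<\dots<u_k\le 1}dx^{i_1}_{u_1}\cdots dx^{i_k}_{u_k},$$ with value $1$ for the empty index, and $S^m(x)\in\mathbb R^{s_d(m)}$, $s_d(m)=\sum_{k=0}^m d^k$, is the vector of all coefficients of order at most $m$. Let $X$ be a random path of bounded variation (the space of paths carries the $\sigma$-algebra generated by the evaluations) and $Y$ a real random variable. Assume that $\mathbb E[Y\mid X]=\langle\beta,S^m(X)\rangle$ a.s. for some $m\in\mathbb N$ and $\beta\in\mathbb R^{s_d(m)}$, let $m^*$ be the smallest such $m$, and let $\beta^*\in\mathbb R^{s_d(m^*)}$ satisfy $\mathbb E[Y\mid X]=\langle\beta^*,S^{m^*}(X)\rangle$ a.s. Assume $\mathrm{Var}(Y\mid X)\le\sigma^2$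 a.s., $\|\beta^*\|\le\alpha$ for some $\alpha>0$, and $|Y|\le K_Y$, $\|X\|_{TV}\le K_X$ a.s. for some $K_X,K_Y>0$. Put $K=2(K_Y+\alpha e^{K_X})e^{K_X}$, $B_{m,\alpha}=\{\beta\in\mathbb R^{s_d(m)}:\|\beta\|\le\alpha\}$ and $$L(m)=\inf_{\beta\in B_{m,\alpha}}\mathbb E\big(Y-\langle\beta,S^m(X)\rangle\big)^2,$$ with the convention $L(-1)=+\infty$, and assume $L(m^*-1)>\sigma^2$. **Estimator.** Let $(X_1,Y_1),\dots,(X_n,Y_n)$ be i.i.d. copies of $(X,Y)$ and $$\widehat L_n(m)=\min_{\beta\in B_{m,\alpha}}\frac1n\sum_{i=1}^n\big(Y_i-\langle\beta,S^m(X_i)\rangle\big)^2 .$$ Let $K_{\rm pen}>0$, $0<\rho<\tfrac12$, $\mathrm{pen}_n(m)=K_{\rm pen}\,n^{-\rho}\sqrt{s_d(m)}$, and let $\widehat m$ be the smallest minimiser over $m\in\mathbb N$ of $\widehat L_n(m)+\mathrm{pen}_n(m)$. **Theorem.** Let $n_0$ be the smallest integer such that $$n_0^{\min(\rho,\frac12-\rho)}\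 \ge\ \big(432K\alpha\sqrt\pi+K_{\rm pen}\big)\Big(\frac{2\sqrt{s_d(m^*+1)}}{L(m^*-1)-\sigma^2}+\frac{\sqrt{2s_d(m^*+1)}}{K_{\rm pen}\sqrt{d^{m^*+1}}}\Big).$$ Then, for every $n\ge n_0$, $$\mathbb P(\widehat m\ne m^*)\le C_1\exp\big(-C_2\,n^{1-2\rho}\big),$$ where $$C_1=74\sum_{m>0}e^{-C_3s_d(m)}+148\,m^*<\infty,\qquad C_3=\frac{K_{\rm pen}^2d^{m^*+1}}{128\,s_d(m^*+1)\,(72K^2\alpha^2+K_Y^2)},$$ $$C_2=\frac1{16(1152K^2\alpha^2+K_Y^2)}\min\Big(\frac{K_{\rm pen}^2d^{m^*+1}}{8\,s_d(m^*+1)},\ L(m^*-1)-\sigma^2\Big).$$ (For $m^*=0$ the convention means that the first fraction in the condition on $n_0$ is $0$ and that the minimum in $C_2$ is its first term.) -/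

import Mathlib

open MeasureTheory ProbabilityTheory

noncomputable section

namespace SignatureRegression

/-- Paths `[0,1] → ℝ^d` of bounded variation. They carry the sigma-algebra generated by the
evaluation maps (the subspace sigma-algebra of the product one). -/
abbrev BVPath (d : ℕ) : Type :=
  {x : unitInterval → EuclideanSpace ℝ (Fin d) // BoundedVariationOn x Set.univ}

/-- The total variation of a path, with respect to the Euclidean norm of `ℝ^d`. -/
def totalVariation {d : ℕ} (x : BVPath d) : ℝ :=
  (eVariationOn x.1 Set.univ).toReal

theorem coord_boundedVariationOn {d : ℕ} (x : BVPath d) (i : Fin d) :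
    BoundedVariationOn (fun t => x.1 t i) Set.univ :=
  (EuclideanSpace.proj i : EuclideanSpace ℝ (Fin d) →L[ℝ] ℝ).lipschitz.comp_boundedVariationOn x.2

/-- The signed Stieltjes measure `dX^i` on `[0,1]` of the `i`-th coordinate of a path; it gives
the mass `X^i_1 - X^i_0` to `[0,1]`. -/
def coordMeasure {d : ℕ} (x : BVPath d) (i : Fin d) : SignedMeasure unitInterval :=
  (coord_boundedVariationOn x i).vectorMeasure

/-- The iterated integral of `dX^{i_1} ⋯ dX^{i_k}` over `0 ≤ u_1 < ⋯ < u_k < t`, for the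
multi-index `I = (i_1, …, i_k)`. -/
def iteratedIntegral {d : ℕ} (x : BVPath d) : (k : ℕ) → (Fin k → Fin d) → unitInterval → ℝ
  | 0, _, _ => 1
  | k + 1, I, t =>
      ∫ᵛ u in Set.Iio t, iteratedIntegral x k (Fin.init I) u ∂•(coordMeasure x (I (Fin.last k)))

/-- The signature coefficient along the multi-index `I = (i_1, …, i_k)`: the iterated integral of
`dX^{i_1} ⋯ dX^{i_k}` over `0 ≤ u_1 < ⋯ < u_k ≤ 1`. It is `1` for the empty multi-index. -/
def sigCoeff {d : ℕ} (x : BVPath d) : (k : ℕ) → (Fin k → Fin d) → ℝ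
  | 0, _ => 1
  | k + 1, I =>
      ∫ᵛ u, iteratedIntegral x k (Fin.init I) u ∂•(coordMeasure x (I (Fin.last k)))

/-- Multi-indices of length at most `m` with entries in `{1, …, d}`. -/
abbrev MultiIndex (d m : ℕ) : Type := (k : Fin (m + 1)) × (Fin k → Fin d)

/-- `s_d(m) = 1 + d + ⋯ + d^m`, the number of signature coefficients of order at most `m`. -/
def sigDim (d m : ℕ) : ℕ := ∑ k ∈ Finset.range (m + 1), d ^ k

theorem card_multiIndex (d m : ℕ) : Fintype.card (MultiIndex d m) = sigDim d m := by
  simp [sigDim, Finset.sum_range]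

/-- The Euclidean space `ℝ^{s_d(m)}`, with coordinates indexed by the multi-indices. -/
abbrev SigSpace (d m : ℕ) : Type := EuclideanSpace ℝ (MultiIndex d m)

/-- The signature `S^m(X)` truncated at order `m`. -/
def truncSig {d : ℕ} (m : ℕ) (x : BVPath d) : SigSpace d m :=
  WithLp.toLp 2 fun I => sigCoeff x I.1 I.2

/-- The theoretical risk `R_m(β) = E (Y - ⟨β, S^m(X)⟩)²`. -/
def risk {d : ℕ} {Ω : Type*} [MeasurableSpace Ω] (μ : Measure Ω) (X : Ω → BVPath d) (Y : Ω → ℝ)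
    (m : ℕ) (β : SigSpace d m) : ℝ :=
  ∫ ω, (Y ω - inner ℝ β (truncSig m (X ω))) ^ 2 ∂μ

/-- The minimal theoretical risk `L(m)` over the ball of radius `α`. -/
def minRisk {d : ℕ} {Ω : Type*} [MeasurableSpace Ω] (μ : Measure Ω) (X : Ω → BVPath d)
    (Y : Ω → ℝ) (α : ℝ) (m : ℕ) : ℝ :=
  sInf (risk μ X Y m '' Metric.closedBall 0 α)

/-- The empirical risk of `β` on the data `(x_1, y_1), …, (x_n, y_n)`. -/
def empRisk {d n : ℕ} (x : Fin n → BVPath d) (y : Fin n → ℝ) (m : ℕ) (β : SigSpace d m) : ℝ :=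
  (1 / (n : ℝ)) * ∑ i, (y i - inner ℝ β (truncSig m (x i))) ^ 2

/-- The minimal empirical risk over the ball of radius `α`. -/
def minEmpRisk {d n : ℕ} (α : ℝ) (x : Fin n → BVPath d) (y : Fin n → ℝ) (m : ℕ) : ℝ :=
  sInf (empRisk x y m '' Metric.closedBall 0 α)

/-- The penalty `pen_n(m) = K_pen n^{-ρ} √(s_d(m))`. -/
def pen (d : ℕ) (Kpen ρ : ℝ) (n m : ℕ) : ℝ :=
  Kpen * (n : ℝ) ^ (-ρ) * √(sigDim d m : ℝ)

/-- The estimator of the truncation order: the smallest minimiser over `m ∈ ℕ` of the penalised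
minimal empirical risk. -/
def mHat {d n : ℕ} (α Kpen ρ : ℝ) (x : Fin n → BVPath d) (y : Fin n → ℝ) : ℕ :=
  sInf {m | ∀ k, minEmpRisk α x y m + pen d Kpen ρ n m ≤ minEmpRisk α x y k + pen d Kpen ρ n k}

/-- `K = 2 (K_Y + α e^{K_X}) e^{K_X}`. -/
def constK (α KX KY : ℝ) : ℝ := 2 * (KY + α * Real.exp KX) * Real.exp KX

/-- The lower bound required of `n_0 ^ min(ρ, 1/2 - ρ)`, where `gap` stands for
`L(m⋆ - 1) - σ²`. For `m⋆ = 0` the convention is `L(-1) = +∞`: the term with `gap` vanishes. -/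
def sampleThreshold (d : ℕ) (α K Kpen gap : ℝ) (mstar : ℕ) : ℝ :=
  (432 * K * α * √Real.pi + Kpen) *
    ((if mstar = 0 then 0 else 2 * √(sigDim d (mstar + 1) : ℝ) / gap) +
      √(2 * (sigDim d (mstar + 1) : ℝ)) / (Kpen * √((d : ℝ) ^ (mstar + 1))))

/-- The constant `C_3`. -/
def const3 (d : ℕ) (α K KY Kpen : ℝ) (mstar : ℕ) : ℝ :=
  Kpen ^ 2 * (d : ℝ) ^ (mstar + 1) /
    (128 * (sigDim d (mstar + 1) : ℝ) * (72 * K ^ 2 * α ^ 2 + KY ^ 2))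

/-- The constant `C_1 = 74 ∑_{m > 0} exp(-C_3 s_d(m)) + 148 m⋆`. -/
def const1 (d : ℕ) (α K KY Kpen : ℝ) (mstar : ℕ) : ℝ :=
  74 * ∑' m : ℕ, Real.exp (-const3 d α K KY Kpen mstar * (sigDim d (m + 1) : ℝ)) + 148 * mstar

/-- The constant `C_2`, where `gap` stands for `L(m⋆ - 1) - σ²`. For `m⋆ = 0` the convention is
`L(-1) = +∞`: the minimum is its first term. -/
def const2 (d : ℕ) (α K KY Kpen gap : ℝ) (mstar : ℕ) : ℝ :=
  1 / (16 * (1152 * K ^ 2 * α ^ 2 + KY ^ 2)) *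
    (if mstar = 0 then
      Kpen ^ 2 * (d : ℝ) ^ (mstar + 1) / (8 * (sigDim d (mstar + 1) : ℝ))
    else
      min (Kpen ^ 2 * (d : ℝ) ^ (mstar + 1) / (8 * (sigDim d (mstar + 1) : ℝ))) gap)

end SignatureRegression

end

open SignatureRegression

/-!
The level-`k` part of the signature is bounded by `‖x‖_TV ^ k / k!`, so the whole signature has norm
at most `exp ‖x‖_TV` and the quadratic losses are bounded. A difference of two quadratic losses is a
linear functional of the bounded vector `s ⊗ (y / α, s)`, so the empirical risks of all coefficient
vectors in the ball are controlled at once by the deviation of a single empirical mean in a Hilbert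
space. That deviation obeys a Hoeffding bound with no dimension in it: `cosh ‖·‖` plays the role of
the moment generating function, since a centred step of norm at most `B` multiplies its expectation
by at most `cosh B`.

Selecting an order above `m*` forces a deviation of at least the difference of the penalties, and
selecting one below `m*` forces a deviation of at least half the gap `L(m* - 1) - σ²`. The
difference of the penalties grows like `√(s_d m)`, which makes the union bound over the orders
summable.
-/

namespace SignatureRegression

section Concentration

open Real

theorem cosh_le_of_sq_le {r a b w : ℝ} (hw₀ : 0 ≤ w) (hw₁ : w ≤ 1)
    (hr : r ^ 2 ≤ w * a ^ 2 + (1 - w) * b ^ 2) : cosh r ≤ w * cosh a + (1 - w) * cosh b := by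
  refine hasSum_le (fun n => ?_) (hasSum_cosh r)
    (((hasSum_cosh a).mul_left w).add ((hasSum_cosh b).mul_left (1 - w)))
  have hconv := (convexOn_pow (𝕜 := ℝ) n).2 (Set.mem_Ici.2 (sq_nonneg a))
    (Set.mem_Ici.2 (sq_nonneg b)) hw₀ (sub_nonneg.2 hw₁) (by ring)
  simp only [smul_eq_mul] at hconv
  have hterm := (pow_le_pow_left₀ (sq_nonneg r) hr n).trans hconv
  simp only [pow_mul]
  rw [← mul_div_assoc, ← mul_div_assoc, ← add_div]
  gcongr

variable {E ι Ω : Type*} [NormedAddCommGroup E] [MeasurableSpace Ω] {P : Measure Ω}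

theorem ae_norm_sum_le {Z : ι → Ω → E} {B : ℝ} (hb : ∀ i, ∀ᵐ ω ∂P, ‖Z i ω‖ ≤ B) (s : Finset ι) :
    ∀ᵐ ω ∂P, ‖∑ i ∈ s, Z i ω‖ ≤ s.card * B := by
  filter_upwards [(ae_ball_iff s.countable_toSet).2 fun i _ => hb i] with ω hω
  simpa using norm_sum_le_of_le s hω

theorem integrable_cosh_norm [MeasurableSpace E] [BorelSpace E] [IsFiniteMeasure P]
    {S : Ω → E} (hS : AEMeasurable S P) {R : ℝ}
    (hR : ∀ᵐ ω ∂P, ‖S ω‖ ≤ R) : Integrable (fun ω => cosh ‖S ω‖) P := by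
  refine Integrable.of_bound
    (continuous_cosh.measurable.comp_aemeasurable hS.norm).aestronglyMeasurable (cosh R) ?_
  filter_upwards [hR] with ω hω
  rw [norm_of_nonneg (cosh_pos _).le]
  exact cosh_le_cosh.2 (by rwa [abs_norm, abs_of_nonneg ((norm_nonneg _).trans hω)])

variable [InnerProductSpace ℝ E]

/-- The vector `v` for which the affine function `cosh ‖s‖ cosh B + ⟨v, z⟩` of `z` dominates
`cosh ‖s + z‖` on the ball of radius `B`; at `s = 0` it is `0`. -/
noncomputable def coshDrift (B : ℝ) (s : E) : E := (sinh ‖s‖ / ‖s‖ * (sinh B / B)) • s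

theorem norm_coshDrift {B : ℝ} (hB : 0 ≤ B) (s : E) :
    ‖coshDrift B s‖ = sinh ‖s‖ * (sinh B / B) := by
  rcases eq_or_ne s 0 with rfl | hs
  · simp [coshDrift]
  have hnn : 0 ≤ sinh ‖s‖ / ‖s‖ * (sinh B / B) := by
    have := sinh_nonneg_iff.2 hB
    have := sinh_nonneg_iff.2 (norm_nonneg s)
    positivity
  rw [coshDrift, norm_smul, norm_of_nonneg hnn, mul_right_comm,
    div_mul_cancel₀ _ (norm_ne_zero_iff.2 hs)]

theorem cosh_norm_add_le (s : E) {z : E} {B : ℝ} (hB : 0 < B) (hz : ‖z‖ ≤ B) :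
    cosh ‖s + z‖ ≤ cosh ‖s‖ * cosh B + inner ℝ (coshDrift B s) z := by
  rcases eq_or_ne s 0 with rfl | hs
  · simpa [coshDrift] using (cosh_le_cosh (x := ‖z‖) (y := B)).2 (by rwa [abs_norm, abs_of_pos hB])
  have hs' : 0 < ‖s‖ := norm_pos_iff.2 hs
  have hsB : 0 < ‖s‖ * B := mul_pos hs' hB
  set θ : ℝ := inner ℝ s z / (‖s‖ * B) with hθ
  have hinner : inner ℝ s z = θ * (‖s‖ * B) := by rw [hθ, div_mul_cancel₀ _ hsB.ne']
  have hθ_abs : |θ| ≤ 1 := by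
    rw [hθ, abs_div, abs_of_pos hsB]
    exact div_le_one_of_le₀ ((abs_real_inner_le_norm s z).trans (by gcongr)) hsB.le
  obtain ⟨hθ_lower, hθ_upper⟩ := abs_le.1 hθ_abs
  have hcosh : cosh ‖s + z‖ ≤
      (1 + θ) / 2 * cosh (‖s‖ + B) + (1 - (1 + θ) / 2) * cosh (‖s‖ - B) := by
    refine cosh_le_of_sq_le (by linarith) (by linarith) ?_
    rw [norm_add_sq_real, hinner]
    have : ‖z‖ ^ 2 ≤ B ^ 2 := by gcongr
    linarith
  rw [coshDrift, inner_smul_left, hinner]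
  rw [cosh_add, cosh_sub] at hcosh
  refine hcosh.trans (le_of_eq ?_)
  simp only [conj_trivial]
  field_simp
  ring

variable [MeasurableSpace E] [BorelSpace E] [SecondCountableTopology E]

theorem measurable_coshDrift (B : ℝ) :
    Measurable (coshDrift B : E → E) :=
  (((continuous_sinh.measurable.comp measurable_norm).div measurable_norm).mul_const _).smul
    measurable_id

variable [CompleteSpace E]

theorem integral_cosh_norm_add_le [IsFiniteMeasure P] {S Z : Ω → E} (hS : AEMeasurable S P)
    (hZ : AEMeasurable Z P) (hindep : IndepFun S Z P) {R B : ℝ} (hB : 0 < B)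
    (hSR : ∀ᵐ ω ∂P, ‖S ω‖ ≤ R) (hZB : ∀ᵐ ω ∂P, ‖Z ω‖ ≤ B) (hmean : ∫ ω, Z ω ∂P = 0) :
    ∫ ω, cosh ‖S ω + Z ω‖ ∂P ≤ (∫ ω, cosh ‖S ω‖ ∂P) * cosh B := by
  have hsum : ∀ᵐ ω ∂P, ‖S ω + Z ω‖ ≤ R + B := by
    filter_upwards [hSR, hZB] with ω hωS hωZ using norm_add_le_of_le hωS hωZ
  have hZint : Integrable Z P := Integrable.of_bound hZ.aestronglyMeasurable B hZB
  have hdrift : Integrable (fun ω => coshDrift B (S ω)) P := by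
    refine Integrable.of_bound
      ((measurable_coshDrift B).comp_aemeasurable hS).aestronglyMeasurable
      (sinh R * (sinh B / B)) ?_
    filter_upwards [hSR] with ω hω
    rw [norm_coshDrift hB.le]
    have := sinh_nonneg_iff.2 hB.le
    gcongr
    exact sinh_le_sinh.2 hω
  have hindep' : IndepFun (fun ω => coshDrift B (S ω)) Z P :=
    hindep.comp (measurable_coshDrift B) measurable_id
  have hinner : Integrable (fun ω => inner ℝ (coshDrift B (S ω)) (Z ω)) P :=
    hindep'.integrable_bilin hdrift hZint (innerSL ℝ)
  have hzero : ∫ ω, inner ℝ (coshDrift B (S ω)) (Z ω) ∂P = 0 :=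
    (hindep'.integral_bilin hdrift hZint (innerSL ℝ)).trans (by rw [hmean, map_zero])
  have hcosh := (integrable_cosh_norm hS hSR).mul_const (cosh B)
  calc ∫ ω, cosh ‖S ω + Z ω‖ ∂P
      ≤ ∫ ω, (cosh ‖S ω‖ * cosh B + inner ℝ (coshDrift B (S ω)) (Z ω)) ∂P := by
        refine integral_mono_ae (integrable_cosh_norm (hS.add hZ) hsum) (hcosh.add hinner) ?_
        filter_upwards [hZB] with ω hω using cosh_norm_add_le _ hB hω
    _ = (∫ ω, cosh ‖S ω‖ ∂P) * cosh B := by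
        rw [integral_add hcosh hinner, hzero, add_zero, integral_mul_const]

theorem integral_cosh_norm_sum_le [IsProbabilityMeasure P] {Z : ι → Ω → E}
    (hZ : ∀ i, AEMeasurable (Z i) P) (hindep : iIndepFun Z P) {B : ℝ} (hB : 0 < B)
    (hb : ∀ i, ∀ᵐ ω ∂P, ‖Z i ω‖ ≤ B) (hmean : ∀ i, ∫ ω, Z i ω ∂P = 0) (s : Finset ι) :
    ∫ ω, cosh ‖∑ i ∈ s, Z i ω‖ ∂P ≤ cosh B ^ s.card := by
  classical
  induction s using Finset.induction_on with
  | empty => simp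
  | insert a s ha ih =>
    have hindep' : IndepFun (fun ω => ∑ i ∈ s, Z i ω) (Z a) P := by
      convert hindep.indepFun_finsetSum_of_notMem₀ hZ ha using 1
      ext ω
      simp
    simp_rw [Finset.sum_insert ha, add_comm (Z a _)]
    rw [Finset.card_insert_of_notMem ha, pow_succ]
    exact (integral_cosh_norm_add_le (Finset.aemeasurable_fun_sum s fun i _ => hZ i) (hZ a) hindep'
      hB (ae_norm_sum_le hb s) (hb a) (hmean a)).trans (by gcongr)

theorem exp_div_two_mul_measureReal_norm_sum_ge_le [IsProbabilityMeasure P] [Fintype ι]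
    {Z : ι → Ω → E} (hZ : ∀ i, AEMeasurable (Z i) P) (hindep : iIndepFun Z P) {B : ℝ} (hB : 0 < B)
    (hb : ∀ i, ∀ᵐ ω ∂P, ‖Z i ω‖ ≤ B) (hmean : ∀ i, ∫ ω, Z i ω ∂P = 0) {t : ℝ} (ht : 0 ≤ t) :
    exp t / 2 * P.real {ω | t ≤ ‖∑ i, Z i ω‖} ≤ exp (Fintype.card ι * (B ^ 2 / 2)) := by
  have hcosh_t : exp t / 2 ≤ cosh t := by
    rw [cosh_eq]
    linarith [exp_pos (-t)]
  have hsub : {ω | t ≤ ‖∑ i, Z i ω‖} ⊆ {ω | cosh t ≤ cosh ‖∑ i, Z i ω‖} :=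
    fun ω (hω : t ≤ _) => cosh_le_cosh.2 (by rwa [abs_norm, abs_of_nonneg ht])
  have hmeas : AEMeasurable (fun ω => ∑ i, Z i ω) P :=
    Finset.aemeasurable_fun_sum _ fun i _ => hZ i
  calc exp t / 2 * P.real {ω | t ≤ ‖∑ i, Z i ω‖}
      ≤ cosh t * P.real {ω | cosh t ≤ cosh ‖∑ i, Z i ω‖} := by
        gcongr ?_ * ?_
        exact measureReal_mono hsub
    _ ≤ ∫ ω, cosh ‖∑ i, Z i ω‖ ∂P :=
        mul_meas_ge_le_integral_of_nonneg (Filter.Eventually.of_forall fun ω => (cosh_pos _).le)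
          (integrable_cosh_norm hmeas (ae_norm_sum_le hb _)) _
    _ ≤ cosh B ^ Fintype.card ι := integral_cosh_norm_sum_le hZ hindep hB hb hmean Finset.univ
    _ ≤ exp (Fintype.card ι * (B ^ 2 / 2)) := by
        rw [exp_nat_mul]
        gcongr
        exact cosh_le_exp_half_sq B

theorem measureReal_norm_sum_ge_le [IsProbabilityMeasure P] [Fintype ι] [Nonempty ι]
    {Z : ι → Ω → E} (hZ : ∀ i, AEMeasurable (Z i) P) (hindep : iIndepFun Z P) {B : ℝ} (hB : 0 < B)
    (hb : ∀ i, ∀ᵐ ω ∂P, ‖Z i ω‖ ≤ B) (hmean : ∀ i, ∫ ω, Z i ω ∂P = 0) {t : ℝ} (ht : 0 < t) :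
    P.real {ω | t ≤ ‖∑ i, Z i ω‖} ≤ 2 * exp (-t ^ 2 / (2 * Fintype.card ι * B ^ 2)) := by
  have hn : (0 : ℝ) < Fintype.card ι := Nat.cast_pos.2 Fintype.card_pos
  set n : ℝ := (Fintype.card ι : ℝ)
  -- The scale `l` minimises the exponent `n (l B)² / 2 - l t`.
  set l : ℝ := t / (n * B ^ 2) with hl
  have hl0 : 0 < l := by positivity
  have hscaled := exp_div_two_mul_measureReal_norm_sum_ge_le (P := P) (Z := fun i ω => l • Z i ω)
    (fun i => (hZ i).const_smul l)
    (hindep.comp (fun _ x => l • x) fun _ => measurable_const_smul l) (mul_pos hl0 hB)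
    (fun i => by
      filter_upwards [hb i] with ω hω
      rw [norm_smul, norm_of_nonneg hl0.le]
      gcongr)
    (fun i => by rw [integral_smul, hmean i, smul_zero]) (mul_pos hl0 ht).le
  simp_rw [← Finset.smul_sum, norm_smul, norm_of_nonneg hl0.le, mul_le_mul_iff_right₀ hl0]
    at hscaled
  have hbound : P.real {ω | t ≤ ‖∑ i, Z i ω‖} ≤
      2 * (exp (n * ((l * B) ^ 2 / 2)) / exp (l * t)) := by
    rw [← mul_div_assoc, le_div_iff₀ (exp_pos _)]
    linarith
  refine hbound.trans (le_of_eq ?_)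
  rw [← exp_sub, hl]
  congr 2
  field_simp
  ring

end Concentration

section VectorMeasure

open Set Filter Topology
open scoped ENNReal

variable {α : Type*} [LinearOrder α] [BoundedOrder α] [DenselyOrdered α] [TopologicalSpace α]
  [OrderTopology α] [SecondCountableTopology α] [CompactIccSpace α] [MeasurableSpace α]
  [BorelSpace α] {E : Type*} [NormedAddCommGroup E] [CompleteSpace E] {f : α → E}

theorem generateFrom_Ioc_le {β : Type*} [LinearOrder β] [TopologicalSpace β] [OrderTopology β]
    [SecondCountableTopology β] [mβ : MeasurableSpace β] [BorelSpace β] :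
    mβ = MeasurableSpace.generateFrom {s | ∃ u v : β, u ≤ v ∧ s = Ioc u v} := by
  convert! borel_eq_generateFrom_Ioc_le β using 2
  · exact BorelSpace.measurable_eq
  · grind only

theorem vectorMeasure_univ_eq_top_sub_bot (hf : BoundedVariationOn f univ) :
    hf.vectorMeasure univ = f ⊤ - f ⊥ := by
  rw [← Icc_bot_top, hf.vectorMeasure_Icc bot_le, rightLim_eq_of_isTop isTop_top,
    leftLim_eq_of_isBot isBot_bot]

theorem enorm_rightLim_sub_le_measure_Ioc (hf : BoundedVariationOn f univ) {u v : α}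
    (huv : u ≤ v) :
    ‖f.rightLim v - f.rightLim u‖ₑ ≤ (hf.stieltjesFunctionRightLim ⊥).measure (Ioc u v) := by
  rw [StieltjesFunction.measure_Ioc, BoundedVariationOn.stieltjesFunctionRightLim_apply,
    BoundedVariationOn.stieltjesFunctionRightLim_apply,
    ← variationOnFromTo.add hf.rightLim.locallyBoundedVariationOn (mem_univ ⊥) (mem_univ u)
      (mem_univ v), add_sub_cancel_left, variationOnFromTo.eq_of_le _ _ huv,
    ENNReal.ofReal_toReal (hf.rightLim.mono inter_subset_left), ← edist_eq_enorm_sub]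
  exact eVariationOn.edist_le _ (by grind) (by grind)

instance (hf : BoundedVariationOn f univ) :
    IsFiniteMeasure (hf.stieltjesFunctionRightLim ⊥).measure :=
  StieltjesFunction.isFiniteMeasure_of_forall_abs_le _ fun _ =>
    variationOnFromTo.abs_le_eVariationOn hf.rightLim

theorem vectorMeasure_eq_add_dirac_bot (hf : BoundedVariationOn f univ) :
    ∃ W : VectorMeasure α E, hf.vectorMeasure = W + VectorMeasure.dirac ⊥ (f.rightLim ⊥ - f ⊥) ∧
      ∀ s, ‖W s‖ₑ ≤ (hf.stieltjesFunctionRightLim ⊥).measure s := by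
  obtain ⟨W, hW, hle⟩ :=
    VectorMeasure.exists_extension_of_isSetSemiring_of_le_measure_of_generateFrom
      (μ := (hf.stieltjesFunctionRightLim ⊥).measure) (m := AddContent.onIoc f.rightLim)
      IsSetSemiring.Ioc (by
        rintro s ⟨u, v, huv, rfl⟩
        rw [AddContent.onIoc_apply huv]
        exact enorm_rightLim_sub_le_measure_Ioc hf huv) generateFrom_Ioc_le
  have hIoc : ∀ u v, u ≤ v → W (Ioc u v) = f.rightLim v - f.rightLim u := fun u v huv => by
    rw [hW _ ⟨u, v, huv, rfl⟩, AddContent.onIoc_apply huv]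
  have hbot : W {⊥} = 0 := by
    rw [← enorm_eq_zero, ← nonpos_iff_eq_zero, ← botSet_eq_singleton_of_isBot isBot_bot]
    exact (hle _).trans (StieltjesFunction.measure_botSet _).le
  have huniv : W univ = f ⊤ - f.rightLim ⊥ := by
    rw [← Icc_bot_top, ← Icc_union_Ioc_eq_Icc le_rfl bot_le, Icc_self,
      VectorMeasure.of_union (by simp) (measurableSet_singleton _) measurableSet_Ioc, hbot,
      hIoc ⊥ ⊤ bot_le, rightLim_eq_of_isTop isTop_top, zero_add]
  refine ⟨W, VectorMeasure.ext_of_generateFrom _ ?_ generateFrom_Ioc_le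
    IsSetSemiring.Ioc.isPiSystem ?_, hle⟩
  · rintro s ⟨u, v, huv, rfl⟩
    rw [add_apply, hIoc u v huv, hf.vectorMeasure_Ioc huv,
      VectorMeasure.dirac_apply_of_notMem (by simp), add_zero]
  · rw [add_apply, vectorMeasure_univ_eq_top_sub_bot, huniv,
      VectorMeasure.dirac_apply_of_mem MeasurableSet.univ (mem_univ _), sub_add_sub_cancel]

theorem measure_stieltjesFunctionRightLim_univ_add_le (hf : BoundedVariationOn f univ) :
    (hf.stieltjesFunctionRightLim ⊥).measure univ + ‖f.rightLim ⊥ - f ⊥‖ₑ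
      ≤ eVariationOn f univ := by
  have hmass : (hf.stieltjesFunctionRightLim ⊥).measure univ = eVariationOn f.rightLim univ := by
    rw [← Icc_bot_top, StieltjesFunction.measure_Icc, leftLim_eq_of_isBot isBot_bot,
      BoundedVariationOn.stieltjesFunctionRightLim_apply,
      BoundedVariationOn.stieltjesFunctionRightLim_apply, variationOnFromTo.self, sub_zero,
      variationOnFromTo.eq_of_le _ _ bot_le, Icc_bot_top, univ_inter,
      ENNReal.ofReal_toReal hf.rightLim]
  have hright : f.rightLim.rightLim ⊥ = f.rightLim ⊥ :=
    rightLim_rightLim (hf.tendsto_rightLim ⊥)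
  have hsplit := hf.eVariationOn_Ici_eq_Ioi_add_edist (a := ⊥)
  have hsplit' := hf.rightLim.eVariationOn_Ici_eq_Ioi_add_edist (a := ⊥)
  rw [Ici_bot] at hsplit hsplit'
  rw [hright, edist_self, add_zero] at hsplit'
  rw [hmass, hsplit, hsplit', ← edist_eq_enorm_sub, edist_comm]
  gcongr
  exact eVariationOn.eVariationOn_rightLim_le isOpen_Ioi

theorem variation_vectorMeasure_univ_le (hf : BoundedVariationOn f univ) :
    hf.vectorMeasure.variation univ ≤ eVariationOn f univ := by
  obtain ⟨W, hW, hle⟩ := vectorMeasure_eq_add_dirac_bot hf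
  calc hf.vectorMeasure.variation univ
      ≤ W.variation univ
        + (VectorMeasure.dirac (⊥ : α) (f.rightLim ⊥ - f ⊥)).variation univ := by
        rw [hW]; exact VectorMeasure.variation_add_le univ
    _ ≤ (hf.stieltjesFunctionRightLim ⊥).measure univ + ‖f.rightLim ⊥ - f ⊥‖ₑ := by
        gcongr
        · exact VectorMeasure.variation_le_of_forall_enorm_le fun s _ => hle s
        · simp
    _ ≤ eVariationOn f univ := measure_stieltjesFunctionRightLim_univ_add_le hf

theorem vectorMeasure_clm_comp [NormedSpace ℝ E] {G : Type*} [NormedAddCommGroup G]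
    [NormedSpace ℝ G] [CompleteSpace G] (hf : BoundedVariationOn f univ) (L : E →L[ℝ] G)
    (hLf : BoundedVariationOn (fun t => L (f t)) univ) (s : Set α) :
    hLf.vectorMeasure s = L (hf.vectorMeasure s) := by
  have hright : ∀ a, (fun t => L (f t)).rightLim a = L (f.rightLim a) := fun a => by
    rcases eq_or_neBot (𝓝[>] a) with h | h
    · rw [rightLim_eq_of_eq_bot _ h, rightLim_eq_of_eq_bot _ h]
    · exact rightLim_eq_of_tendsto ((L.continuous.tendsto _).comp (hf.tendsto_rightLim a))
  have hmap : hLf.vectorMeasure =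
      hf.vectorMeasure.mapRange (L : E →ₗ[ℝ] G).toAddMonoidHom L.continuous := by
    refine VectorMeasure.ext_of_generateFrom _ ?_ generateFrom_Ioc_le
      IsSetSemiring.Ioc.isPiSystem ?_
    · rintro s ⟨u, v, huv, rfl⟩
      change _ = L (hf.vectorMeasure (Ioc u v))
      simp only [hf.vectorMeasure_Ioc huv, hLf.vectorMeasure_Ioc huv, hright, map_sub]
    · change _ = L (hf.vectorMeasure univ)
      simp only [vectorMeasure_univ_eq_top_sub_bot, map_sub]
  rw [hmap]; rfl

end VectorMeasure

section PathMeasure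

open Set

variable {d : ℕ}

theorem coordMeasure_apply (x : BVPath d) (i : Fin d) (s : Set unitInterval) :
    coordMeasure x i s = x.2.vectorMeasure s i :=
  vectorMeasure_clm_comp x.2 (EuclideanSpace.proj i : EuclideanSpace ℝ (Fin d) →L[ℝ] ℝ)
    (coord_boundedVariationOn x i) s

/-- The variation `|dX|` of the vector-valued Stieltjes measure of a path; its mass is at most the
total variation of the path. -/
noncomputable def variationMeasure (x : BVPath d) : Measure unitInterval :=
  x.2.vectorMeasure.variation

instance (x : BVPath d) : IsFiniteMeasure (variationMeasure x) :=
  ⟨(variation_vectorMeasure_univ_le x.2).trans_lt x.2.lt_top⟩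

theorem variationMeasure_real_univ_le (x : BVPath d) :
    (variationMeasure x).real univ ≤ totalVariation x :=
  ENNReal.toReal_mono x.2 (variation_vectorMeasure_univ_le x.2)

theorem norm_coordMeasure_le (x : BVPath d) (s : Set unitInterval) :
    ‖(WithLp.toLp 2 fun i => coordMeasure x i s : EuclideanSpace ℝ (Fin d))‖ ≤
      (variationMeasure x).real s := by
  simp_rw [coordMeasure_apply]
  exact VectorMeasure.norm_measure_le_variation (measure_ne_top (variationMeasure x) s)

end PathMeasure

section Riemann

open Set Filter Topology

/-- The index `j` of the cell `(j / (n + 1), (j + 1) / (n + 1)]` which contains `u`, the first cell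
being closed. -/
noncomputable def gridIndex (n : ℕ) (u : unitInterval) : ℕ := ⌈(u : ℝ) * (n + 1)⌉₊ - 1

/-- The point `j / (n + 1)` of the regular grid, clamped to `[0,1]`. -/
noncomputable def gridPoint (n j : ℕ) : unitInterval := projIcc 0 1 zero_le_one ((j : ℝ) / (n + 1))

/-- The `j`-th cell of the regular grid; left-open cells make the value at the left end point the
right choice for Riemann sums of left-continuous functions. -/
def gridCell (n j : ℕ) : Set unitInterval := gridIndex n ⁻¹' {j}

theorem measurable_gridIndex (n : ℕ) : Measurable (gridIndex n) :=
  (measurable_from_nat (f := fun j => j - 1)).comp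
    (Nat.measurable_ceil.comp (measurable_subtype_coe.mul_const _))

theorem measurableSet_gridCell (n j : ℕ) : MeasurableSet (gridCell n j) :=
  measurable_gridIndex n (measurableSet_singleton j)

theorem gridIndex_lt (n : ℕ) (u : unitInterval) : gridIndex n u < n + 1 := by
  have hceil : ⌈(u : ℝ) * (n + 1)⌉₊ ≤ n + 1 := by
    rw [Nat.ceil_le]
    push_cast
    exact mul_le_of_le_one_left (by positivity) u.2.2
  unfold gridIndex
  omega

theorem coe_gridPoint {n j : ℕ} (hj : j < n + 1) : (gridPoint n j : ℝ) = (j : ℝ) / (n + 1) := by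
  have hmem : (j : ℝ) / (n + 1) ∈ Icc (0 : ℝ) 1 := by
    refine ⟨by positivity, div_le_one_of_le₀ ?_ (by positivity)⟩
    exact_mod_cast hj.le
  rw [gridPoint, projIcc_of_mem _ hmem]

theorem gridPoint_gridIndex_le (n : ℕ) (u : unitInterval) : gridPoint n (gridIndex n u) ≤ u := by
  rw [← Subtype.coe_le_coe, coe_gridPoint (gridIndex_lt n u), div_le_iff₀ (by positivity)]
  unfold gridIndex
  rcases Nat.eq_zero_or_pos ⌈(u : ℝ) * (n + 1)⌉₊ with h | h
  · rw [h]
    simpa using mul_nonneg u.2.1 (by positivity)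
  · exact (Nat.lt_ceil.1 (by omega)).le

theorem sub_le_gridPoint_gridIndex (n : ℕ) (u : unitInterval) :
    (u : ℝ) - 1 / (n + 1) ≤ gridPoint n (gridIndex n u) := by
  rw [coe_gridPoint (gridIndex_lt n u), sub_le_iff_le_add, ← add_div, le_div_iff₀ (by positivity)]
  refine (Nat.le_ceil _).trans ?_
  unfold gridIndex
  exact_mod_cast Nat.le_add_of_sub_le le_rfl

theorem gridIndex_lt_of_lt_gridPoint {n j : ℕ} (hj : j < n + 1) {u : unitInterval}
    (h : u < gridPoint n j) : gridIndex n u < j := by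
  rw [← Subtype.coe_lt_coe, coe_gridPoint hj, lt_div_iff₀ (by positivity)] at h
  have hceil : ⌈(u : ℝ) * (n + 1)⌉₊ ≤ j := Nat.ceil_le.2 h.le
  have hpos : 0 < j := by
    have : (0 : ℝ) < j := (mul_nonneg u.2.1 (by positivity)).trans_lt h
    exact_mod_cast this
  unfold gridIndex
  omega

theorem tendsto_gridPoint_gridIndex (u : unitInterval) :
    Tendsto (fun n => gridPoint n (gridIndex n u)) atTop (𝓝[≤] u) := by
  refine tendsto_nhdsWithin_iff.2 ⟨?_, Eventually.of_forall fun n => gridPoint_gridIndex_le n u⟩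
  rw [tendsto_subtype_rng]
  refine tendsto_of_tendsto_of_tendsto_of_le_of_le (g := fun n : ℕ => (u : ℝ) - 1 / (n + 1))
    ?_ tendsto_const_nhds (fun n => sub_le_gridPoint_gridIndex n u)
    (fun n => Subtype.coe_le_coe.2 (gridPoint_gridIndex_le n u))
  simpa using tendsto_const_nhds.sub (tendsto_one_div_add_atTop_nhds_zero_nat (𝕜 := ℝ))

theorem measurable_comp_gridPoint_gridIndex {β : Type*} [MeasurableSpace β] (f : unitInterval → β)
    (n : ℕ) : Measurable fun u => f (gridPoint n (gridIndex n u)) :=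
  (measurable_from_nat (f := fun j => f (gridPoint n j))).comp (measurable_gridIndex n)

theorem measurable_of_continuousWithinAt_Iic {β : Type*} [TopologicalSpace β]
    [TopologicalSpace.PseudoMetrizableSpace β] [MeasurableSpace β] [BorelSpace β]
    {f : unitInterval → β} (hf : ∀ u, ContinuousWithinAt f (Iic u) u) : Measurable f :=
  measurable_of_tendsto_metrizable (measurable_comp_gridPoint_gridIndex f)
    (tendsto_pi_nhds.2 fun u => (hf u).tendsto.comp (tendsto_gridPoint_gridIndex u))

instance {α : Type*} [MeasurableSpace α] (μ : SignedMeasure α) : IsFiniteMeasure μ.variation := by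
  rw [← SignedMeasure.totalVariation_eq_variation, SignedMeasure.totalVariation]
  infer_instance

theorem sum_mul_gridCell_eq_setIntegral (μ : SignedMeasure unitInterval) (f : unitInterval → ℝ)
    {S : Set unitInterval} (hS : MeasurableSet S) (n : ℕ) :
    ∑ j ∈ Finset.range (n + 1), f (gridPoint n j) * μ (gridCell n j ∩ S) =
      ∫ᵛ u in S, f (gridPoint n (gridIndex n u)) ∂•μ := by
  have hsum : ∀ u, f (gridPoint n (gridIndex n u)) =
      ∑ j ∈ Finset.range (n + 1), (gridCell n j).indicator (fun _ => f (gridPoint n j)) u := by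
    intro u
    rw [Finset.sum_eq_single_of_mem (gridIndex n u) (Finset.mem_range.2 (gridIndex_lt n u))]
    · rw [indicator_of_mem (by simp [gridCell])]
    · intro j _ hj
      rw [indicator_of_notMem (by simpa [gridCell] using hj.symm)]
  simp_rw [hsum]
  rw [VectorMeasure.integral_finsetSum]
  · refine Finset.sum_congr rfl fun j _ => ?_
    rw [VectorMeasure.integral_indicator_const _ (measurableSet_gridCell n j),
      VectorMeasure.restrict_apply _ hS (measurableSet_gridCell n j)]
    simp
  · intro j _
    exact (integrable_const _).indicator (measurableSet_gridCell n j)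

theorem tendsto_sum_mul_gridCell (μ : SignedMeasure unitInterval) {f : unitInterval → ℝ} {C : ℝ}
    (hb : ∀ u, |f u| ≤ C) (hf : ∀ u, ContinuousWithinAt f (Iic u) u) {S : Set unitInterval}
    (hS : MeasurableSet S) :
    Tendsto (fun n : ℕ => ∑ j ∈ Finset.range (n + 1), f (gridPoint n j) * μ (gridCell n j ∩ S))
      atTop (𝓝 (∫ᵛ u in S, f u ∂•μ)) := by
  simp_rw [sum_mul_gridCell_eq_setIntegral μ f hS]
  exact VectorMeasure.tendsto_integral_of_dominated_convergence (fun _ => C)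
    (fun n => (measurable_comp_gridPoint_gridIndex f n).aestronglyMeasurable)
    (integrable_const _) (fun n => Eventually.of_forall fun u => hb _)
    (Eventually.of_forall fun u => (hf u).tendsto.comp (tendsto_gridPoint_gridIndex u))

theorem continuousWithinAt_setIntegral_Iio {α : Type*} [LinearOrder α] [TopologicalSpace α]
    [OrderTopology α] [FirstCountableTopology α] [MeasurableSpace α] [OpensMeasurableSpace α]
    (μ : SignedMeasure α) {f : α → ℝ} {C : ℝ} (hb : ∀ u, |f u| ≤ C) (hf : Measurable f) (t : α) :
    ContinuousWithinAt (fun t => ∫ᵛ u in Iio t, f u ∂•μ) (Iic t) t := by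
  simp_rw [← VectorMeasure.integral_indicator measurableSet_Iio]
  refine VectorMeasure.tendsto_integral_filter_of_dominated_convergence (fun _ => C)
    (Eventually.of_forall fun s => (hf.indicator measurableSet_Iio).aestronglyMeasurable)
    (Eventually.of_forall fun s => Eventually.of_forall fun u =>
      (norm_indicator_le_norm_self _ _).trans (hb u)) (integrable_const _)
    (Eventually.of_forall fun u => ?_)
  rcases lt_or_ge u t with hut | htu
  · refine tendsto_const_nhds.congr' ?_
    filter_upwards [mem_nhdsWithin_of_mem_nhds (Ioi_mem_nhds hut)] with s hus
    rw [indicator_of_mem (mem_Iio.2 hut), indicator_of_mem (mem_Iio.2 hus)]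
  · refine tendsto_const_nhds.congr' ?_
    filter_upwards [self_mem_nhdsWithin] with s hst
    rw [indicator_of_notMem (notMem_Iio.2 htu),
      indicator_of_notMem (notMem_Iio.2 ((mem_Iic.1 hst).trans htu))]

theorem mul_pow_mul_sub_le {p q : ℝ} (hp : 0 ≤ p) (hpq : p ≤ q) (k : ℕ) :
    (k + 1) * (p ^ k * (q - p)) ≤ q ^ (k + 1) - p ^ (k + 1) := by
  have hterm : ∀ i ∈ Finset.range (k + 1), p ^ k ≤ q ^ i * p ^ (k + 1 - 1 - i) := fun i hi =>
    calc p ^ k = p ^ i * p ^ (k + 1 - 1 - i) := by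
          rw [← pow_add]; congr 1; have := Finset.mem_range.1 hi; omega
      _ ≤ q ^ i * p ^ (k + 1 - 1 - i) := by gcongr
  rw [← geom_sum₂_mul, ← mul_assoc]
  gcongr
  simpa using Finset.card_nsmul_le_sum _ _ _ hterm

theorem sum_pow_div_factorial_mul_sub_le {a : ℕ → ℝ} (ha : Monotone a) (h0 : 0 ≤ a 0) (k N : ℕ) :
    ∑ j ∈ Finset.range N, a j ^ k / k.factorial * (a (j + 1) - a j) ≤
      a N ^ (k + 1) / (k + 1).factorial := by
  have hnn : ∀ j, 0 ≤ a j := fun j => h0.trans (ha (Nat.zero_le j))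
  have hstep : ∀ j, a j ^ k / k.factorial * (a (j + 1) - a j) ≤
      a (j + 1) ^ (k + 1) / (k + 1).factorial - a j ^ (k + 1) / (k + 1).factorial := fun j => by
    have htangent := mul_pow_mul_sub_le (hnn j) (ha j.le_succ) k
    rw [← sub_div, div_mul_eq_mul_div, div_le_div_iff₀ (by positivity) (by positivity),
      Nat.factorial_succ]
    push_cast
    nlinarith [(Nat.cast_pos (α := ℝ)).2 (Nat.factorial_pos k)]
  refine (Finset.sum_le_sum fun j _ => hstep j).trans ?_
  rw [Finset.sum_range_sub fun j => a j ^ (k + 1) / (k + 1).factorial]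
  exact sub_le_self _ (div_nonneg (pow_nonneg h0 _) (Nat.cast_nonneg _))

theorem measureReal_gridCell_inter (V : Measure unitInterval) [IsFiniteMeasure V]
    {S : Set unitInterval} (hS : MeasurableSet S) (n j : ℕ) :
    V.real (gridCell n j ∩ S) =
      V.real (gridIndex n ⁻¹' Iio (j + 1) ∩ S) - V.real (gridIndex n ⁻¹' Iio j ∩ S) := by
  have hcell : gridCell n j ∩ S =
      (gridIndex n ⁻¹' Iio (j + 1) ∩ S) \ (gridIndex n ⁻¹' Iio j ∩ S) := by
    ext u
    simp only [gridCell, mem_inter_iff, mem_preimage, mem_singleton_iff, Set.mem_sdiff]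
    grind
  rw [hcell, measureReal_sdiff (by gcongr; simp)
    ((measurable_gridIndex n measurableSet_Iio).inter hS)]

theorem sum_measureReal_Iio_gridPoint_le (V : Measure unitInterval) [IsFiniteMeasure V]
    {S : Set unitInterval} (hS : MeasurableSet S) (hS' : IsLowerSet S) (k n : ℕ) :
    ∑ j ∈ Finset.range (n + 1),
      V.real (Iio (gridPoint n j)) ^ k / k.factorial * V.real (gridCell n j ∩ S) ≤
        V.real S ^ (k + 1) / (k + 1).factorial := by
  set a : ℕ → ℝ := fun j => V.real (gridIndex n ⁻¹' Iio j ∩ S)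
  have hmono : Monotone a := fun i j hij => measureReal_mono (by gcongr)
  have hcell : ∀ j ∈ Finset.range (n + 1),
      V.real (Iio (gridPoint n j)) ^ k / k.factorial * V.real (gridCell n j ∩ S) ≤
        a j ^ k / k.factorial * (a (j + 1) - a j) := fun j hj => by
    rw [← measureReal_gridCell_inter V hS]
    rcases (gridCell n j ∩ S).eq_empty_or_nonempty with hempty | ⟨u, hu, huS⟩
    · simp [hempty]
    · have hle : gridPoint n j ≤ u := (mem_singleton_iff.1 hu) ▸ gridPoint_gridIndex_le n u
      have hsub : Iio (gridPoint n j) ⊆ gridIndex n ⁻¹' Iio j ∩ S := fun w hw =>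
        ⟨gridIndex_lt_of_lt_gridPoint (Finset.mem_range.1 hj) hw, hS' ((le_of_lt hw).trans hle) huS⟩
      gcongr
      exact measureReal_mono hsub
  calc _ ≤ ∑ j ∈ Finset.range (n + 1), a j ^ k / k.factorial * (a (j + 1) - a j) :=
        Finset.sum_le_sum hcell
    _ ≤ a (n + 1) ^ (k + 1) / (k + 1).factorial :=
        sum_pow_div_factorial_mul_sub_le hmono measureReal_nonneg k (n + 1)
    _ ≤ V.real S ^ (k + 1) / (k + 1).factorial := by
        gcongr ?_ ^ (k + 1) / _
        exact measureReal_mono inter_subset_right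

end Riemann

section Bound

open Set Filter Topology

variable {d : ℕ}

/-- The vector of all iterated integrals of order `k` up to time `t`, that is, the `k`-th level of
the signature of the path stopped just before `t`. -/
noncomputable def iteratedVector (x : BVPath d) (k : ℕ) (t : unitInterval) :
    EuclideanSpace ℝ (Fin k → Fin d) :=
  WithLp.toLp 2 fun I => iteratedIntegral x k I t

theorem norm_toLp_init_mul_last (k : ℕ) (a : (Fin k → Fin d) → ℝ) (b : Fin d → ℝ) :
    ‖(WithLp.toLp 2 fun I : Fin (k + 1) → Fin d => a (Fin.init I) * b (I (Fin.last k)) :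
      EuclideanSpace ℝ (Fin (k + 1) → Fin d))‖ =
    ‖(WithLp.toLp 2 a : EuclideanSpace ℝ (Fin k → Fin d))‖ *
      ‖(WithLp.toLp 2 b : EuclideanSpace ℝ (Fin d))‖ := by
  simp only [EuclideanSpace.norm_eq, Real.norm_eq_abs, sq_abs]
  rw [← Real.sqrt_mul (Finset.sum_nonneg fun _ _ => sq_nonneg _), Finset.sum_mul_sum,
    ← Finset.sum_product']
  congr 1
  refine Fintype.sum_equiv ((Fin.snocEquiv (fun _ : Fin (k + 1) => Fin d)).symm.trans
    (Equiv.prodComm _ _)) _ _ fun I => ?_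
  simp [Fin.snocEquiv, mul_pow]

theorem abs_iteratedIntegral_le_of_norm_iteratedVector_le {x : BVPath d} {k : ℕ}
    (hk : ∀ t, ‖iteratedVector x k t‖ ≤ (variationMeasure x).real (Iio t) ^ k / k.factorial)
    (I : Fin k → Fin d) (t : unitInterval) :
    |iteratedIntegral x k I t| ≤ (variationMeasure x).real univ ^ k / k.factorial :=
  calc |iteratedIntegral x k I t| ≤ ‖iteratedVector x k t‖ :=
        PiLp.norm_apply_le (iteratedVector x k t) I
    _ ≤ (variationMeasure x).real (Iio t) ^ k / k.factorial := hk t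
    _ ≤ (variationMeasure x).real univ ^ k / k.factorial := by
        gcongr ?_ ^ k / _
        exact measureReal_mono (subset_univ _)

theorem norm_setIntegral_iteratedIntegral_le {x : BVPath d} {k : ℕ}
    (hk : ∀ t, ‖iteratedVector x k t‖ ≤ (variationMeasure x).real (Iio t) ^ k / k.factorial)
    (hc : ∀ I t, ContinuousWithinAt (iteratedIntegral x k I) (Iic t) t)
    {S : Set unitInterval} (hS : MeasurableSet S) (hS' : IsLowerSet S) :
    ‖(WithLp.toLp 2 fun I : Fin (k + 1) → Fin d => ∫ᵛ u in S,
      iteratedIntegral x k (Fin.init I) u ∂•(coordMeasure x (I (Fin.last k))) :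
        EuclideanSpace ℝ (Fin (k + 1) → Fin d))‖ ≤
      (variationMeasure x).real S ^ (k + 1) / (k + 1).factorial := by
  have hlim : Tendsto (fun n : ℕ => ∑ j ∈ Finset.range (n + 1),
      (WithLp.toLp 2 fun I : Fin (k + 1) → Fin d =>
        iteratedIntegral x k (Fin.init I) (gridPoint n j) *
          coordMeasure x (I (Fin.last k)) (gridCell n j ∩ S) :
        EuclideanSpace ℝ (Fin (k + 1) → Fin d))) atTop
      (𝓝 (WithLp.toLp 2 fun I : Fin (k + 1) → Fin d => ∫ᵛ u in S,
        iteratedIntegral x k (Fin.init I) u ∂•(coordMeasure x (I (Fin.last k))))) := by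
    simp_rw [← WithLp.toLp_sum]
    refine ((PiLp.continuous_toLp 2 _).tendsto _).comp (tendsto_pi_nhds.2 fun I => ?_)
    simpa only [Finset.sum_apply] using tendsto_sum_mul_gridCell _
      (abs_iteratedIntegral_le_of_norm_iteratedVector_le hk _) (hc _) hS
  refine le_of_tendsto hlim.norm (Eventually.of_forall fun n => ?_)
  calc _ ≤ ∑ j ∈ Finset.range (n + 1), (variationMeasure x).real (Iio (gridPoint n j)) ^ k /
        k.factorial * (variationMeasure x).real (gridCell n j ∩ S) := by
        refine norm_sum_le_of_le _ fun j _ => ?_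
        rw [norm_toLp_init_mul_last k (fun I => iteratedIntegral x k I (gridPoint n j))
          fun i => coordMeasure x i (gridCell n j ∩ S)]
        exact mul_le_mul (hk _) (norm_coordMeasure_le x _) (norm_nonneg _) (by positivity)
    _ ≤ _ := sum_measureReal_Iio_gridPoint_le _ hS hS' k n

theorem norm_iteratedVector_le_and_continuousWithinAt (x : BVPath d) (k : ℕ) :
    (∀ t, ‖iteratedVector x k t‖ ≤ (variationMeasure x).real (Iio t) ^ k / k.factorial) ∧
      ∀ I t, ContinuousWithinAt (iteratedIntegral x k I) (Iic t) t := by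
  induction k with
  | zero =>
    refine ⟨fun t => ?_, fun _ _ => continuousWithinAt_const⟩
    simp [iteratedVector, iteratedIntegral, EuclideanSpace.norm_eq]
  | succ k ih =>
    obtain ⟨hk, hc⟩ := ih
    exact ⟨fun t => norm_setIntegral_iteratedIntegral_le hk hc measurableSet_Iio (isLowerSet_Iio t),
      fun I t => continuousWithinAt_setIntegral_Iio _
        (abs_iteratedIntegral_le_of_norm_iteratedVector_le hk _)
        (measurable_of_continuousWithinAt_Iic (hc _)) t⟩

theorem norm_sigCoeff_le (x : BVPath d) (k : ℕ) :
    ‖(WithLp.toLp 2 fun I : Fin k → Fin d => sigCoeff x k I :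
      EuclideanSpace ℝ (Fin k → Fin d))‖ ≤ totalVariation x ^ k / k.factorial := by
  rcases k with _ | k
  · simp [sigCoeff, EuclideanSpace.norm_eq]
  · obtain ⟨hk, hc⟩ := norm_iteratedVector_le_and_continuousWithinAt x k
    have hbound := norm_setIntegral_iteratedIntegral_le hk hc MeasurableSet.univ isLowerSet_univ
    simp only [VectorMeasure.restrict_univ] at hbound
    refine hbound.trans ?_
    gcongr
    exact variationMeasure_real_univ_le x

theorem norm_truncSig_le (m : ℕ) (x : BVPath d) :
    ‖truncSig m x‖ ≤ Real.exp (totalVariation x) := by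
  have hTV : 0 ≤ totalVariation x := ENNReal.toReal_nonneg
  refine le_trans ?_ (Real.sum_le_exp_of_nonneg hTV (m + 1))
  refine le_of_sq_le_sq ?_ (Finset.sum_nonneg fun k _ => by positivity)
  calc ‖truncSig m x‖ ^ 2
      = ∑ k : Fin (m + 1), ‖(WithLp.toLp 2 fun I : Fin k → Fin d => sigCoeff x k I :
          EuclideanSpace ℝ (Fin k → Fin d))‖ ^ 2 := by
        simp_rw [EuclideanSpace.norm_sq_eq]
        exact Fintype.sum_sigma _
    _ ≤ ∑ k : Fin (m + 1), (totalVariation x ^ (k : ℕ) / (k : ℕ).factorial) ^ 2 := by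
        gcongr with k
        exact norm_sigCoeff_le x k
    _ = ∑ k ∈ Finset.range (m + 1), (totalVariation x ^ k / k.factorial) ^ 2 :=
        (Finset.sum_range fun k => (totalVariation x ^ k / k.factorial) ^ 2).symm
    _ ≤ _ := Finset.sum_sq_le_sq_sum_of_nonneg fun k _ => by positivity

end Bound

section Measurability

open Set Filter Topology

variable {d : ℕ}

theorem measurable_eval_coord (i : Fin d) (a : unitInterval) :
    Measurable fun x : BVPath d => x.1 a i :=
  (EuclideanSpace.proj i : EuclideanSpace ℝ (Fin d) →L[ℝ] ℝ).continuous.measurable.comp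
    ((measurable_pi_apply a).comp measurable_subtype_coe)

theorem measurable_rightLim_coord (i : Fin d) (a : unitInterval) :
    Measurable fun x : BVPath d => (fun t => x.1 t i).rightLim a := by
  rcases eq_or_neBot (𝓝[>] a) with h | h
  · simp_rw [rightLim_eq_of_eq_bot _ h]
    exact measurable_eval_coord i a
  · obtain ⟨u, hu⟩ := exists_seq_tendsto (𝓝[>] a)
    exact measurable_of_tendsto_metrizable (fun n => measurable_eval_coord i (u n))
      (tendsto_pi_nhds.2 fun x => ((coord_boundedVariationOn x i).tendsto_rightLim a).comp hu)

theorem measurable_coordMeasure (i : Fin d) {s : Set unitInterval} (hs : MeasurableSet s) :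
    Measurable fun x : BVPath d => coordMeasure x i s := by
  have huniv : Measurable fun x : BVPath d => coordMeasure x i univ := by
    simp_rw [coordMeasure, vectorMeasure_univ_eq_top_sub_bot]
    exact (measurable_eval_coord i ⊤).sub (measurable_eval_coord i ⊥)
  induction s, hs using MeasurableSpace.induction_on_inter
    (generateFrom_Ioc_le (β := unitInterval)) IsSetSemiring.Ioc.isPiSystem with
  | empty => simp
  | basic s hs =>
    obtain ⟨u, w, huw, rfl⟩ := hs
    simp_rw [coordMeasure, BoundedVariationOn.vectorMeasure_Ioc _ huw]
    exact (measurable_rightLim_coord i w).sub (measurable_rightLim_coord i u)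
  | compl s hs ih =>
    have hcompl : ∀ x : BVPath d,
        coordMeasure x i sᶜ = coordMeasure x i univ - coordMeasure x i s := fun x => by
      rw [← VectorMeasure.of_add_of_sdiff hs MeasurableSet.univ (subset_univ s),
        compl_eq_univ_sdiff, add_sub_cancel_left]
    simp_rw [hcompl]
    exact huniv.sub ih
  | iUnion f hd hm ih =>
    exact measurable_of_tendsto_metrizable
      (fun n => Finset.measurable_fun_sum (Finset.range n) fun j _ => ih j)
      (tendsto_pi_nhds.2 fun x =>
        ((coordMeasure x i).hasSum_of_disjoint_iUnion hm hd).tendsto_sum_nat)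

theorem measurable_setIntegral_iteratedIntegral {k : ℕ} {I : Fin k → Fin d}
    (hI : ∀ t, Measurable fun x : BVPath d => iteratedIntegral x k I t) (i : Fin d)
    {S : Set unitInterval} (hS : MeasurableSet S) :
    Measurable fun x : BVPath d => ∫ᵛ u in S, iteratedIntegral x k I u ∂•(coordMeasure x i) := by
  refine measurable_of_tendsto_metrizable (f := fun (n : ℕ) (x : BVPath d) =>
    ∑ j ∈ Finset.range (n + 1), iteratedIntegral x k I (gridPoint n j) *
      coordMeasure x i (gridCell n j ∩ S))
    (fun n => Finset.measurable_fun_sum _ fun j _ => (hI _).mul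
      (measurable_coordMeasure i ((measurableSet_gridCell n j).inter hS)))
    (tendsto_pi_nhds.2 fun x => ?_)
  obtain ⟨hk, hc⟩ := norm_iteratedVector_le_and_continuousWithinAt x k
  exact tendsto_sum_mul_gridCell _ (abs_iteratedIntegral_le_of_norm_iteratedVector_le hk I)
    (hc I) hS

theorem measurable_iteratedIntegral (k : ℕ) (I : Fin k → Fin d) (t : unitInterval) :
    Measurable fun x : BVPath d => iteratedIntegral x k I t := by
  induction k generalizing t with
  | zero => exact measurable_const
  | succ k ih => exact measurable_setIntegral_iteratedIntegral (fun t => ih _ t) _ measurableSet_Iio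

theorem measurable_sigCoeff (k : ℕ) (I : Fin k → Fin d) :
    Measurable fun x : BVPath d => sigCoeff x k I := by
  rcases k with _ | k
  · exact measurable_const
  · simpa only [VectorMeasure.restrict_univ, sigCoeff] using measurable_setIntegral_iteratedIntegral
      (fun t => measurable_iteratedIntegral k (Fin.init I) t) (I (Fin.last k)) MeasurableSet.univ

theorem measurable_truncSig (m : ℕ) : Measurable (truncSig m : BVPath d → SigSpace d m) :=
  (PiLp.continuous_toLp 2 _).measurable.comp
    (measurable_pi_lambda _ fun I => measurable_sigCoeff I.1 I.2)

end Measurability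

section Sample

variable {Ω₀ Ω β γ ι : Type*} [MeasurableSpace Ω₀] [MeasurableSpace Ω] [MeasurableSpace β]
  [MeasurableSpace γ]

/-- The family `Zs` on `(Ω, P)` consists of independent copies of the variable `Z` on `(Ω₀, μ)`. -/
structure IsIIDSample (P : Measure Ω) (μ : Measure Ω₀) (Zs : ι → Ω → β) (Z : Ω₀ → β) : Prop where
  iIndepFun : iIndepFun Zs P
  identDistrib : ∀ i, IdentDistrib (Zs i) Z P μ

variable {P : Measure Ω} {μ : Measure Ω₀}

theorem IsIIDSample.comp {Zs : ι → Ω → β} {Z : Ω₀ → β} (h : IsIIDSample P μ Zs Z) {f : β → γ}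
    (hf : Measurable f) : IsIIDSample P μ (fun i ω => f (Zs i ω)) fun ω => f (Z ω) :=
  ⟨h.iIndepFun.comp (fun _ => f) fun _ => hf, fun i => (h.identDistrib i).comp hf⟩

theorem IsIIDSample.measureReal_norm_sum_sub_integral_ge_le {E : Type*} [NormedAddCommGroup E]
    [InnerProductSpace ℝ E] [CompleteSpace E] [SecondCountableTopology E] [MeasurableSpace E]
    [BorelSpace E] [IsProbabilityMeasure P] [IsProbabilityMeasure μ] [Fintype ι] [Nonempty ι]
    {Zs : ι → Ω → E} {Z : Ω₀ → E} (h : IsIIDSample P μ Zs Z) {b : ℝ} (hb : 0 < b)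
    (hZ : ∀ᵐ ω ∂μ, ‖Z ω‖ ≤ b) {t : ℝ} (ht : 0 < t) :
    P.real {ω | t ≤ ‖∑ i, (Zs i ω - ∫ ω', Z ω' ∂μ)‖} ≤
      2 * Real.exp (-t ^ 2 / (2 * Fintype.card ι * (2 * b) ^ 2)) := by
  set w := ∫ ω, Z ω ∂μ with hw
  obtain ⟨hindep, hident⟩ := h.comp (measurable_sub_const w)
  have hmeas : AEMeasurable Z μ :=
    (h.identDistrib (Classical.arbitrary ι)).aemeasurable_snd
  have hwb : ‖w‖ ≤ b := by simpa using norm_integral_le_of_norm_le_const hZ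
  have hbound : ∀ᵐ ω ∂μ, ‖Z ω - w‖ ≤ 2 * b := by
    filter_upwards [hZ] with ω hω
    exact (norm_sub_le _ _).trans (by linarith)
  have hmean : ∫ ω, (Z ω - w) ∂μ = 0 := by
    rw [integral_sub (Integrable.of_bound hmeas.aestronglyMeasurable b hZ) (integrable_const _)]
    simp [hw]
  exact measureReal_norm_sum_ge_le (fun i => (hident i).aemeasurable_fst) hindep (by positivity)
    (fun i => (hident i).symm.ae_snd (measurableSet_le measurable_norm measurable_const) hbound)
    (fun i => (hident i).integral_eq.trans hmean) ht

end Sample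

section QuadraticLoss

open scoped TensorProduct

variable {H : Type*} [NormedAddCommGroup H] [InnerProductSpace ℝ H] {α : ℝ}

/-- The feature `s ⊗ (y / α, s)` of an observation `(s, y)`, in which quadratic losses are linear.
The scale `α`, meant to be a bound on the coefficients, balances the two parts of the loss. -/
noncomputable def lossFeature (α y : ℝ) (s : H) : H ⊗[ℝ] WithLp 2 (ℝ × H) :=
  s ⊗ₜ WithLp.toLp 2 (y / α, s)

/-- The linear functional of `lossFeature α y s` equal to the loss of the coefficient vector `β`, up
to the loss `y ^ 2` of the zero coefficient. -/
noncomputable def lossDirection (α : ℝ) (β : H) : H ⊗[ℝ] WithLp 2 (ℝ × H) :=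
  β ⊗ₜ WithLp.toLp 2 (-2 * α, β)

theorem inner_lossDirection (hα : α ≠ 0) (y : ℝ) (s β : H) :
    inner ℝ (lossDirection α β) (lossFeature α y s) = (y - inner ℝ β s) ^ 2 - y ^ 2 := by
  simp only [lossDirection, lossFeature, TensorProduct.inner_tmul, WithLp.prod_inner_apply,
    RCLike.inner_apply, conj_trivial]
  field_simp
  ring

theorem norm_lossFeature_le (hα : 0 < α) {y K e : ℝ} {s : H} (hy : |y| ≤ K) (hs : ‖s‖ ≤ e) :
    ‖lossFeature α y s‖ ≤ (K + α * e) * e / α := by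
  have he : 0 ≤ e := (norm_nonneg s).trans hs
  have hK : 0 ≤ K := (abs_nonneg y).trans hy
  have hpair : ‖(WithLp.toLp 2 (y / α, s) : WithLp 2 (ℝ × H))‖ ≤ K / α + e := by
    rw [WithLp.prod_norm_eq_of_L2]
    refine Real.sqrt_le_iff.2 ⟨by positivity, ?_⟩
    have hyα : ‖y / α‖ ≤ K / α := by rw [norm_div, Real.norm_of_nonneg hα.le]; gcongr; exact hy
    calc ‖y / α‖ ^ 2 + ‖s‖ ^ 2 ≤ (K / α) ^ 2 + e ^ 2 := by gcongr
      _ ≤ (K / α + e) ^ 2 := pow_add_pow_le (by positivity) he two_ne_zero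
  calc ‖lossFeature α y s‖ = ‖s‖ * ‖(WithLp.toLp 2 (y / α, s) : WithLp 2 (ℝ × H))‖ :=
        TensorProduct.norm_tmul _ _
    _ ≤ e * (K / α + e) := by gcongr
    _ = (K + α * e) * e / α := by field_simp

theorem norm_lossDirection_le {β : H} (hβ : ‖β‖ ≤ α) : ‖lossDirection α β‖ ≤ 5 / 2 * α ^ 2 := by
  have hα : 0 ≤ α := (norm_nonneg β).trans hβ
  have hpair : ‖(WithLp.toLp 2 (-2 * α, β) : WithLp 2 (ℝ × H))‖ ≤ 5 / 2 * α := by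
    rw [WithLp.prod_norm_eq_of_L2]
    refine Real.sqrt_le_iff.2 ⟨by positivity, ?_⟩
    calc ‖-2 * α‖ ^ 2 + ‖β‖ ^ 2 ≤ (2 * α) ^ 2 + α ^ 2 := by
          rw [Real.norm_eq_abs, sq_abs]; gcongr ?_ + ?_ ^ 2; exact (by ring : _ = _).le
      _ ≤ (5 / 2 * α) ^ 2 := by nlinarith [sq_nonneg α]
  calc ‖lossDirection α β‖ = ‖β‖ * ‖(WithLp.toLp 2 (-2 * α, β) : WithLp 2 (ℝ × H))‖ :=
        TensorProduct.norm_tmul _ _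
    _ ≤ α * (5 / 2 * α) := by gcongr
    _ = 5 / 2 * α ^ 2 := by ring

theorem continuous_lossFeature (α : ℝ) :
    Continuous fun p : H × ℝ => lossFeature α p.2 p.1 := by
  unfold lossFeature
  fun_prop

theorem continuous_quadraticLoss (β : H) :
    Continuous fun p : H × ℝ => (p.2 - inner ℝ β p.1) ^ 2 := by
  fun_prop

theorem norm_quadraticLoss_le {y K e : ℝ} {s : H} (hy : |y| ≤ K) (hs : ‖s‖ ≤ e) (β : H) :
    ‖(y - inner ℝ β s) ^ 2‖ ≤ (K + ‖β‖ * e) ^ 2 := by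
  rw [norm_pow]
  gcongr
  exact (norm_sub_le _ _).trans (add_le_add hy ((norm_inner_le_norm _ _).trans (by gcongr)))

theorem norm_lossDirection_sub_le {β β' : H} (hβ : ‖β‖ ≤ α) (hβ' : ‖β'‖ ≤ α) :
    ‖lossDirection α β - lossDirection α β'‖ ≤ 5 * α ^ 2 :=
  (norm_sub_le _ _).trans (by linarith [norm_lossDirection_le hβ, norm_lossDirection_le hβ'])

theorem abs_mean_loss_sub_sub_inner_le {ι : Type*} [Fintype ι] [Nonempty ι] (hα : α ≠ 0)
    (y : ι → ℝ) (s : ι → H) (w : H ⊗[ℝ] WithLp 2 (ℝ × H)) {β β' : H} (hβ : ‖β‖ ≤ α)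
    (hβ' : ‖β'‖ ≤ α) :
    |1 / (Fintype.card ι : ℝ) * ∑ i, (y i - inner ℝ β (s i)) ^ 2 -
        1 / (Fintype.card ι : ℝ) * ∑ i, (y i - inner ℝ β' (s i)) ^ 2 -
        inner ℝ (lossDirection α β - lossDirection α β') w| ≤
      1 / (Fintype.card ι : ℝ) * (5 * α ^ 2 * ‖∑ i, (lossFeature α (y i) (s i) - w)‖) := by
  have hn : (Fintype.card ι : ℝ) ≠ 0 := Nat.cast_ne_zero.2 Fintype.card_ne_zero
  have hlinear : 1 / (Fintype.card ι : ℝ) * ∑ i, (y i - inner ℝ β (s i)) ^ 2 -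
        1 / (Fintype.card ι : ℝ) * ∑ i, (y i - inner ℝ β' (s i)) ^ 2 -
        inner ℝ (lossDirection α β - lossDirection α β') w =
      1 / (Fintype.card ι : ℝ) * inner ℝ (lossDirection α β - lossDirection α β')
        (∑ i, (lossFeature α (y i) (s i) - w)) := by
    simp only [inner_sum, inner_sub_right, inner_sub_left, inner_lossDirection hα,
      Finset.sum_sub_distrib, Finset.sum_const, Finset.card_univ, ← Nat.cast_smul_eq_nsmul ℝ,
      real_inner_smul_right]
    field_simp
    ring
  rw [hlinear, abs_mul, abs_of_nonneg (by positivity)]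
  gcongr
  exact (abs_real_inner_le_norm _ _).trans
    (mul_le_mul_of_nonneg_right (norm_lossDirection_sub_le hβ hβ') (norm_nonneg _))

end QuadraticLoss

section Deviation

open scoped TensorProduct

variable {H : Type*} [NormedAddCommGroup H] [InnerProductSpace ℝ H]
  [MeasurableSpace H] [BorelSpace H] {Ω₀ Ω ι : Type*} [MeasurableSpace Ω₀] [MeasurableSpace Ω]
  {μ : Measure Ω₀} {P : Measure Ω} {S : Ω₀ → H} {Y : Ω₀ → ℝ} {α e K : ℝ}

theorem integrable_quadraticLoss [IsFiniteMeasure μ] (hS : AEMeasurable S μ)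
    (hY : AEMeasurable Y μ) (hSb : ∀ᵐ ω ∂μ, ‖S ω‖ ≤ e) (hYb : ∀ᵐ ω ∂μ, |Y ω| ≤ K) (β : H) :
    Integrable (fun ω => (Y ω - inner ℝ β (S ω)) ^ 2) μ := by
  refine Integrable.of_bound ((continuous_quadraticLoss β).measurable.comp_aemeasurable
    (hS.prodMk hY)).aestronglyMeasurable ((K + ‖β‖ * e) ^ 2) ?_
  filter_upwards [hSb, hYb] with ω hs hy using norm_quadraticLoss_le hy hs β

variable [FiniteDimensional ℝ H]

theorem integrable_lossFeature [IsFiniteMeasure μ] (hα : 0 < α) (hS : AEMeasurable S μ)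
    (hY : AEMeasurable Y μ) (hSb : ∀ᵐ ω ∂μ, ‖S ω‖ ≤ e) (hYb : ∀ᵐ ω ∂μ, |Y ω| ≤ K) :
    Integrable (fun ω => lossFeature α (Y ω) (S ω)) μ := by
  refine Integrable.of_bound ((continuous_lossFeature α).stronglyMeasurable.aestronglyMeasurable
    |>.comp_aemeasurable (hS.prodMk hY)) ((K + α * e) * e / α) ?_
  filter_upwards [hSb, hYb] with ω hs hy using norm_lossFeature_le hα hy hs

theorem integral_loss_sub_integral_loss [IsFiniteMeasure μ] (hα : 0 < α) (hS : AEMeasurable S μ)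
    (hY : AEMeasurable Y μ) (hSb : ∀ᵐ ω ∂μ, ‖S ω‖ ≤ e) (hYb : ∀ᵐ ω ∂μ, |Y ω| ≤ K) (β β' : H) :
    ∫ ω, (Y ω - inner ℝ β (S ω)) ^ 2 ∂μ - ∫ ω, (Y ω - inner ℝ β' (S ω)) ^ 2 ∂μ =
      inner ℝ (lossDirection α β - lossDirection α β') (∫ ω, lossFeature α (Y ω) (S ω) ∂μ) := by
  have := FiniteDimensional.complete ℝ (H ⊗[ℝ] WithLp 2 (ℝ × H))
  rw [← integral_inner (integrable_lossFeature hα hS hY hSb hYb),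
    ← integral_sub (integrable_quadraticLoss hS hY hSb hYb β)
      (integrable_quadraticLoss hS hY hSb hYb β')]
  simp only [inner_sub_left, inner_lossDirection hα.ne', sub_sub_sub_cancel_right]

/-- The empirical risks of all pairs of coefficients are controlled at once, since their differences
depend linearly on a single random vector. -/
theorem measureReal_exists_lossDeviation_ge_le [IsProbabilityMeasure μ] [IsProbabilityMeasure P]
    [Fintype ι] [Nonempty ι] {Ss : ι → Ω → H} {Ys : ι → Ω → ℝ}
    (h : IsIIDSample P μ (fun i ω => (Ss i ω, Ys i ω)) fun ω => (S ω, Y ω))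
    (hSb : ∀ᵐ ω ∂μ, ‖S ω‖ ≤ e) (hYb : ∀ᵐ ω ∂μ, |Y ω| ≤ K)
    (hα : 0 < α) (he : 0 < e) (hK : 0 < K) {D : ℝ} (hD : 0 < D) :
    P.real {ω | ∃ β β' : H, ‖β‖ ≤ α ∧ ‖β'‖ ≤ α ∧
      D ≤ |1 / (Fintype.card ι : ℝ) * ∑ i, (Ys i ω - inner ℝ β (Ss i ω)) ^ 2 -
          1 / (Fintype.card ι : ℝ) * ∑ i, (Ys i ω - inner ℝ β' (Ss i ω)) ^ 2 -
        (∫ ω, (Y ω - inner ℝ β (S ω)) ^ 2 ∂μ - ∫ ω, (Y ω - inner ℝ β' (S ω)) ^ 2 ∂μ)|} ≤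
      2 * Real.exp (-(Fintype.card ι * D ^ 2 /
        (50 * (2 * (K + α * e) * e) ^ 2 * α ^ 2))) := by
  have hn : (0 : ℝ) < Fintype.card ι := Nat.cast_pos.2 Fintype.card_pos
  have hSY := (h.identDistrib (Classical.arbitrary ι)).aemeasurable_snd
  have := FiniteDimensional.proper_real (H ⊗[ℝ] WithLp 2 (ℝ × H))
  borelize (H ⊗[ℝ] WithLp 2 (ℝ × H))
  have hfeature : ∀ᵐ ω ∂μ, ‖lossFeature α (Y ω) (S ω)‖ ≤ (K + α * e) * e / α := by
    filter_upwards [hSb, hYb] with ω hs hy using norm_lossFeature_le hα hy hs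
  have hsample := h.comp (continuous_lossFeature α).measurable
  have hconc := hsample.measureReal_norm_sum_sub_integral_ge_le (b := (K + α * e) * e / α)
    (by positivity) hfeature (t := Fintype.card ι * D / (5 * α ^ 2)) (by positivity)
  refine (measureReal_mono ?_).trans (hconc.trans (le_of_eq ?_))
  · rintro ω ⟨β, β', hβ, hβ', hle⟩
    rw [integral_loss_sub_integral_loss hα hSY.fst hSY.snd hSb hYb] at hle
    have hlinear := hle.trans (abs_mean_loss_sub_sub_inner_le hα.ne' (fun i => Ys i ω)
      (fun i => Ss i ω) _ hβ hβ')
    rw [one_div, inv_mul_eq_div, le_div_iff₀ hn] at hlinear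
    change Fintype.card ι * D / (5 * α ^ 2) ≤ _
    rw [div_le_iff₀ (by positivity)]
    linarith
  · congr 2
    field_simp
    ring

end Deviation

section Padding

variable {d m M : ℕ}

/-- The inclusion of the multi-indices of length at most `m` into those of length at most `M`. -/
def castMultiIndex (h : m ≤ M) (I : MultiIndex d m) : MultiIndex d M :=
  ⟨Fin.castLE (Nat.succ_le_succ h) I.1, I.2⟩

theorem castMultiIndex_injective (h : m ≤ M) :
    Function.Injective (castMultiIndex (d := d) h) := by
  rintro ⟨k, f⟩ ⟨k', f'⟩ hk
  simp only [castMultiIndex, Sigma.mk.injEq, Fin.castLE_inj] at hk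
  obtain ⟨rfl, hf⟩ := hk
  simpa using hf

/-- Extension of a coefficient vector by zero to the multi-indices of higher order; it turns models
of different orders into models of a common order. -/
noncomputable def padSig (h : m ≤ M) (β : SigSpace d m) : SigSpace d M :=
  WithLp.toLp 2 (Function.extend (castMultiIndex h) β 0)

theorem padSig_castMultiIndex (h : m ≤ M) (β : SigSpace d m) (I : MultiIndex d m) :
    padSig h β (castMultiIndex h I) = β I :=
  (castMultiIndex_injective h).extend_apply _ _ _

theorem padSig_of_notMem_range (h : m ≤ M) (β : SigSpace d m) {J : MultiIndex d M}
    (hJ : J ∉ Set.range (castMultiIndex h)) : padSig h β J = 0 := by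
  rw [padSig]; exact Function.extend_apply' _ _ _ hJ

theorem norm_padSig (h : m ≤ M) (β : SigSpace d m) : ‖padSig h β‖ = ‖β‖ := by
  rw [EuclideanSpace.norm_eq, EuclideanSpace.norm_eq]
  congr 1
  refine (Fintype.sum_of_injective (castMultiIndex h) (castMultiIndex_injective h) _ _
    (fun J hJ => ?_) fun I => ?_).symm
  · simp [padSig_of_notMem_range h β hJ]
  · rw [padSig_castMultiIndex]

theorem inner_padSig (h : m ≤ M) (β : SigSpace d m) (x : BVPath d) :
    inner ℝ (padSig h β) (truncSig M x) = inner ℝ β (truncSig m x) := by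
  rw [PiLp.inner_apply, PiLp.inner_apply]
  refine (Fintype.sum_of_injective (castMultiIndex h) (castMultiIndex_injective h) _ _
    (fun J hJ => ?_) fun I => ?_).symm
  · rw [padSig_of_notMem_range h β hJ, inner_zero_left]
  · rw [padSig_castMultiIndex]
    rfl

theorem empRisk_padSig {n : ℕ} (h : m ≤ M) (x : Fin n → BVPath d) (y : Fin n → ℝ)
    (β : SigSpace d m) : empRisk x y M (padSig h β) = empRisk x y m β := by
  simp only [empRisk, inner_padSig]

theorem risk_padSig {Ω : Type*} [MeasurableSpace Ω] (μ : Measure Ω) (X : Ω → BVPath d)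
    (Y : Ω → ℝ) (h : m ≤ M) (β : SigSpace d m) :
    risk μ X Y M (padSig h β) = risk μ X Y m β := by
  simp only [risk, inner_padSig]

end Padding

section ConditionalVariance

variable {Ω : Type*} {m m₀ : MeasurableSpace Ω} {μ : Measure[m₀] Ω} {Y g : Ω → ℝ}

theorem condVar_sub_of_stronglyMeasurable (hm : m ≤ m₀) [SigmaFinite (μ.trim hm)]
    (hY : Integrable Y μ) (hg : Integrable g μ) (hgm : StronglyMeasurable[m] g) :
    Var[Y - g; μ | m] =ᵐ[μ] Var[Y; μ | m] := by
  refine condExp_congr_ae ?_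
  filter_upwards [condExp_sub hY hg m] with ω hω
  simp only [Pi.sub_apply, Pi.pow_apply, hω, condExp_of_stronglyMeasurable hm hgm hg]
  ring

theorem integral_condVar_le_integral_sub_sq (hm : m ≤ m₀) [IsFiniteMeasure μ] (hY : MemLp Y 2 μ)
    (hg : MemLp g 2 μ) (hgm : StronglyMeasurable[m] g) :
    ∫ ω, Var[Y; μ | m] ω ∂μ ≤ ∫ ω, (Y ω - g ω) ^ 2 ∂μ := by
  calc ∫ ω, Var[Y; μ | m] ω ∂μ = ∫ ω, Var[Y - g; μ | m] ω ∂μ :=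
        integral_congr_ae (condVar_sub_of_stronglyMeasurable hm (hY.integrable one_le_two)
          (hg.integrable one_le_two) hgm).symm
    _ ≤ ∫ ω, (μ[(Y - g) ^ 2 | m]) ω ∂μ :=
        integral_mono_ae integrable_condVar integrable_condExp
          (condVar_ae_le_condExp_sq hm (hY.sub hg))
    _ = ∫ ω, (Y ω - g ω) ^ 2 ∂μ := integral_condExp hm

theorem integral_sub_sq_eq_integral_condVar (hm : m ≤ m₀) [IsFiniteMeasure μ]
    (hg : μ[Y | m] =ᵐ[μ] g) : ∫ ω, (Y ω - g ω) ^ 2 ∂μ = ∫ ω, Var[Y; μ | m] ω ∂μ := by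
  refine Eq.trans (integral_congr_ae ?_) (integral_condExp hm).symm
  filter_upwards [hg] with ω hω
  simp [hω]

end ConditionalVariance

section Risk

variable {d : ℕ} {Ω₀ Ω : Type*} [MeasurableSpace Ω₀] [MeasurableSpace Ω] {μ : Measure Ω₀}
  {P : Measure Ω} {X : Ω₀ → BVPath d} {Y : Ω₀ → ℝ} {KX KY α σ : ℝ} {m M mstar n : ℕ}

/-- A random path and a random response, both almost surely bounded: the standing assumption on the
observations. -/
structure IsBoundedPair (μ : Measure Ω₀) (X : Ω₀ → BVPath d) (Y : Ω₀ → ℝ) (KX KY : ℝ) : Prop where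
  measurable_path : Measurable X
  measurable_response : Measurable Y
  totalVariation_le : ∀ᵐ ω ∂μ, totalVariation (X ω) ≤ KX
  abs_response_le : ∀ᵐ ω ∂μ, |Y ω| ≤ KY

namespace IsBoundedPair

variable (h : IsBoundedPair μ X Y KX KY)

include h

theorem norm_truncSig_le (m : ℕ) : ∀ᵐ ω ∂μ, ‖truncSig m (X ω)‖ ≤ Real.exp KX := by
  filter_upwards [h.totalVariation_le] with ω hω
  exact (SignatureRegression.norm_truncSig_le m _).trans (Real.exp_le_exp.2 hω)

theorem memLp_response [IsFiniteMeasure μ] : MemLp Y 2 μ :=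
  MemLp.of_bound h.measurable_response.aestronglyMeasurable KY h.abs_response_le

theorem memLp_inner_truncSig [IsFiniteMeasure μ] (β : SigSpace d m) :
    MemLp (fun ω => inner ℝ β (truncSig m (X ω))) 2 μ := by
  refine MemLp.of_bound (((measurable_truncSig m).comp
    h.measurable_path).const_inner).aestronglyMeasurable (‖β‖ * Real.exp KX) ?_
  filter_upwards [h.norm_truncSig_le m] with ω hω
  exact (norm_inner_le_norm _ _).trans (by gcongr)

theorem integral_condVar_le_risk [IsFiniteMeasure μ] (β : SigSpace d m) :
    ∫ ω, Var[Y; μ | MeasurableSpace.comap X inferInstance] ω ∂μ ≤ risk μ X Y m β :=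
  integral_condVar_le_integral_sub_sq h.measurable_path.comap_le h.memLp_response
    (h.memLp_inner_truncSig β)
    (((measurable_truncSig m).const_inner (c := β)).comp (comap_measurable X)).stronglyMeasurable

theorem risk_eq_integral_condVar [IsFiniteMeasure μ] {β : SigSpace d m}
    (hβ : μ[Y | MeasurableSpace.comap X inferInstance] =ᵐ[μ]
      fun ω => inner ℝ β (truncSig m (X ω))) :
    risk μ X Y m β = ∫ ω, Var[Y; μ | MeasurableSpace.comap X inferInstance] ω ∂μ :=
  integral_sub_sq_eq_integral_condVar h.measurable_path.comap_le hβ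

theorem risk_le_risk_of_condExp [IsFiniteMeasure μ] {βstar : SigSpace d mstar}
    (hβstar : μ[Y | MeasurableSpace.comap X inferInstance] =ᵐ[μ]
      fun ω => inner ℝ βstar (truncSig mstar (X ω))) (β : SigSpace d m) :
    risk μ X Y mstar βstar ≤ risk μ X Y m β :=
  (h.risk_eq_integral_condVar hβstar).trans_le (h.integral_condVar_le_risk β)

theorem risk_le_of_condVar_le [IsProbabilityMeasure μ] {β : SigSpace d m}
    (hβ : μ[Y | MeasurableSpace.comap X inferInstance] =ᵐ[μ]
      fun ω => inner ℝ β (truncSig m (X ω)))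
    (hσ : ∀ᵐ ω ∂μ, Var[Y; μ | MeasurableSpace.comap X inferInstance] ω ≤ σ ^ 2) :
    risk μ X Y m β ≤ σ ^ 2 :=
  calc risk μ X Y m β = ∫ ω, Var[Y; μ | MeasurableSpace.comap X inferInstance] ω ∂μ :=
        h.risk_eq_integral_condVar hβ
    _ ≤ ∫ _, σ ^ 2 ∂μ := integral_mono_ae integrable_condVar (integrable_const _) hσ
    _ = σ ^ 2 := by simp

theorem measureReal_exists_riskDeviation_ge_le [IsProbabilityMeasure μ] [IsProbabilityMeasure P]
    (hα : 0 < α) (hKY : 0 < KY) (hn : 0 < n) {Xs : Fin n → Ω → BVPath d} {Ys : Fin n → Ω → ℝ}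
    (hs : IsIIDSample P μ (fun i ω => (Xs i ω, Ys i ω)) fun ω => (X ω, Y ω)) (m : ℕ) {D : ℝ}
    (hD : 0 < D) :
    P.real {ω | ∃ β β' : SigSpace d m, ‖β‖ ≤ α ∧ ‖β'‖ ≤ α ∧
      D ≤ |empRisk (fun i => Xs i ω) (fun i => Ys i ω) m β -
          empRisk (fun i => Xs i ω) (fun i => Ys i ω) m β' -
        (risk μ X Y m β - risk μ X Y m β')|} ≤
      2 * Real.exp (-(n * D ^ 2 / (50 * constK α KX KY ^ 2 * α ^ 2))) := by
  have : Nonempty (Fin n) := Fin.pos_iff_nonempty.1 hn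
  have hfeatures := hs.comp (f := fun p => (truncSig m p.1, p.2))
    (((measurable_truncSig m).comp measurable_fst).prodMk measurable_snd)
  simpa only [empRisk, risk, constK, Fintype.card_fin] using
    measureReal_exists_lossDeviation_ge_le hfeatures
    (h.norm_truncSig_le m) h.abs_response_le hα (Real.exp_pos KX) hKY hD

end IsBoundedPair

theorem risk_nonneg (m : ℕ) (β : SigSpace d m) : 0 ≤ risk μ X Y m β :=
  integral_nonneg fun _ => sq_nonneg _

theorem minRisk_le_risk (h : m ≤ M) {β : SigSpace d m} (hβ : ‖β‖ ≤ α) :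
    minRisk μ X Y α M ≤ risk μ X Y m β := by
  rw [← risk_padSig μ X Y h β]
  refine csInf_le ⟨0, ?_⟩ ⟨padSig h β, by simpa [norm_padSig] using hβ, rfl⟩
  rintro _ ⟨b, -, rfl⟩
  exact risk_nonneg _ _

theorem minRisk_le_sq [IsProbabilityMeasure μ] (hα : 0 ≤ α) (hYb : ∀ᵐ ω ∂μ, |Y ω| ≤ KY) (m : ℕ) :
    minRisk μ X Y α m ≤ KY ^ 2 := by
  have hsq : ∀ᵐ ω ∂μ, ‖Y ω ^ 2‖ ≤ KY ^ 2 := by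
    filter_upwards [hYb] with ω hω
    rw [norm_pow]
    exact pow_le_pow_left₀ (norm_nonneg _) hω 2
  calc minRisk μ X Y α m ≤ risk μ X Y m 0 := minRisk_le_risk le_rfl (by simpa using hα)
    _ = ∫ ω, Y ω ^ 2 ∂μ := by simp only [risk, inner_zero_left, sub_zero]
    _ ≤ KY ^ 2 := by
      simpa using (le_abs_self _).trans (norm_integral_le_of_norm_le_const hsq)

end Risk

section SigDim

variable {d : ℕ}

theorem sigDim_mono (d : ℕ) : Monotone (sigDim d) := fun _ _ h =>
  Finset.sum_le_sum_of_subset (Finset.range_mono (Nat.succ_le_succ h))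

theorem one_le_sigDim (d m : ℕ) : (1 : ℝ) ≤ sigDim d m := by
  have h := sigDim_mono d (Nat.zero_le m)
  exact_mod_cast h

theorem lt_sigDim (hd : d ≠ 0) (m : ℕ) : m < sigDim d m := by
  calc m < ∑ k ∈ Finset.range (m + 1), 1 := by simp
    _ ≤ sigDim d m := Finset.sum_le_sum fun k _ => Nat.one_le_pow _ _ (Nat.pos_of_ne_zero hd)

theorem sigDim_succ (d m : ℕ) : sigDim d (m + 1) = sigDim d m + d ^ (m + 1) :=
  Finset.sum_range_succ _ _

theorem sigDim_le_pow (hd : 2 ≤ d) (m : ℕ) : sigDim d m ≤ d ^ (m + 1) :=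
  (Nat.geomSum_lt hd fun _ hk => Finset.mem_range.1 hk).le

theorem tendsto_sqrt_sigDim_atTop (hd : d ≠ 0) :
    Filter.Tendsto (fun m => √(sigDim d m : ℝ)) Filter.atTop Filter.atTop :=
  Real.tendsto_sqrt_atTop.comp (tendsto_natCast_atTop_atTop.comp
    (Filter.tendsto_atTop_mono (fun m => (lt_sigDim hd m).le) Filter.tendsto_id))

theorem summable_exp_neg_mul_sigDim_succ (hd : d ≠ 0) {c : ℝ} (hc : 0 < c) :
    Summable fun m : ℕ => Real.exp (-c * (sigDim d (m + 1) : ℝ)) := by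
  refine Summable.of_nonneg_of_le (fun _ => (Real.exp_pos _).le) (fun m => ?_)
    (Real.summable_exp_nat_mul_iff.2 (neg_lt_zero.2 hc))
  have hm : (m : ℝ) ≤ sigDim d (m + 1) := by
    exact_mod_cast (Nat.le_succ m).trans (lt_sigDim hd (m + 1)).le
  rw [mul_comm (m : ℝ)]
  exact Real.exp_le_exp.2 (mul_le_mul_of_nonpos_left hm (by linarith))

theorem exp_neg_mul_sigDim_add_le {c : ℝ} (hc : 0 < c) (k j : ℕ) :
    Real.exp (-c * (sigDim d (k + 1 + j) : ℝ)) ≤ Real.exp (-c * (sigDim d (j + 1) : ℝ)) := by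
  have hmono : (sigDim d (j + 1) : ℝ) ≤ sigDim d (k + 1 + j) :=
    Nat.cast_le.2 (sigDim_mono d (by omega))
  exact Real.exp_le_exp.2 (mul_le_mul_of_nonpos_left hmono (by linarith))

end SigDim

section Penalty

variable {d n k m : ℕ} {Kpen ρ : ℝ}

theorem pen_nonneg (hKpen : 0 ≤ Kpen) : 0 ≤ pen d Kpen ρ n m := by
  unfold pen; positivity

theorem pen_sub_pen :
    pen d Kpen ρ n m - pen d Kpen ρ n k =
      Kpen * (n : ℝ) ^ (-ρ) * (√(sigDim d m : ℝ) - √(sigDim d k : ℝ)) := by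
  unfold pen; ring

theorem pen_coeff_pos (hKpen : 0 < Kpen) (hn : 0 < n) : 0 < Kpen * (n : ℝ) ^ (-ρ) :=
  mul_pos hKpen (Real.rpow_pos_of_pos (Nat.cast_pos.2 hn) _)

theorem tendsto_pen_atTop (hd : d ≠ 0) (hKpen : 0 < Kpen) (hn : 0 < n) :
    Filter.Tendsto (pen d Kpen ρ n) Filter.atTop Filter.atTop :=
  (tendsto_sqrt_sigDim_atTop hd).const_mul_atTop (pen_coeff_pos hKpen hn)

theorem pen_lt_pen (hd : d ≠ 0) (hKpen : 0 < Kpen) (hn : 0 < n) (h : k < m) :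
    pen d Kpen ρ n k < pen d Kpen ρ n m := by
  have hlt : sigDim d k < sigDim d (k + 1) := by
    rw [sigDim_succ]
    exact Nat.lt_add_of_pos_right (Nat.pow_pos (Nat.pos_of_ne_zero hd))
  exact mul_lt_mul_of_pos_left (Real.sqrt_lt_sqrt (Nat.cast_nonneg _)
    (Nat.cast_lt.2 (hlt.trans_le (sigDim_mono d h)))) (pen_coeff_pos hKpen hn)

end Penalty

section Estimator

variable {d n : ℕ} {α Kpen ρ : ℝ} (x : Fin n → BVPath d) (y : Fin n → ℝ)

theorem empRisk_nonneg (m : ℕ) (β : SigSpace d m) : 0 ≤ empRisk x y m β := by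
  unfold empRisk; positivity

theorem minEmpRisk_le {m : ℕ} {β : SigSpace d m} (hβ : ‖β‖ ≤ α) :
    minEmpRisk α x y m ≤ empRisk x y m β := by
  refine csInf_le ⟨0, ?_⟩ ⟨β, by simpa using hβ, rfl⟩
  rintro _ ⟨b, -, rfl⟩
  exact empRisk_nonneg _ _ _ _

theorem minEmpRisk_nonneg (m : ℕ) : 0 ≤ minEmpRisk α x y m := by
  refine Real.sInf_nonneg ?_
  rintro _ ⟨β, -, rfl⟩
  exact empRisk_nonneg x y m β

theorem exists_empRisk_eq_minEmpRisk (hα : 0 ≤ α) (m : ℕ) :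
    ∃ β : SigSpace d m, ‖β‖ ≤ α ∧ empRisk x y m β = minEmpRisk α x y m := by
  have hc : Continuous (empRisk x y m) := by unfold empRisk; fun_prop
  obtain ⟨β, hβ, h⟩ := (isCompact_closedBall (0 : SigSpace d m) α).exists_sInf_image_eq
    (Metric.nonempty_closedBall.2 hα) hc.continuousOn
  exact ⟨β, by simpa using hβ, h.symm⟩

/-- The penalised minimal empirical risk, the criterion that `mHat` minimises. -/
noncomputable def penEmpRisk (α Kpen ρ : ℝ) (x : Fin n → BVPath d) (y : Fin n → ℝ) (m : ℕ) : ℝ :=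
  minEmpRisk α x y m + pen d Kpen ρ n m

theorem penEmpRisk_mHat_le (hd : d ≠ 0) (hn : 0 < n) (hKpen : 0 < Kpen) (m : ℕ) :
    penEmpRisk α Kpen ρ x y (mHat α Kpen ρ x y) ≤ penEmpRisk α Kpen ρ x y m := by
  have htendsto : Filter.Tendsto (penEmpRisk α Kpen ρ x y) Filter.cofinite Filter.atTop :=
    Nat.cofinite_eq_atTop ▸ Filter.tendsto_atTop_mono
      (fun m => le_add_of_nonneg_left (minEmpRisk_nonneg x y m)) (tendsto_pen_atTop hd hKpen hn)
  exact Nat.sInf_mem (s := {m | ∀ k, penEmpRisk α Kpen ρ x y m ≤ penEmpRisk α Kpen ρ x y k})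
    htendsto.exists_forall_le m

theorem setOf_mHat_ne_subset {Ω : Type*} (Xs : Fin n → Ω → BVPath d) (Ys : Fin n → Ω → ℝ)
    (hd : d ≠ 0) (hn : 0 < n) (hKpen : 0 < Kpen) (k : ℕ) :
    {ω | mHat α Kpen ρ (fun i => Xs i ω) (fun i => Ys i ω) ≠ k} ⊆
      ⋃ m ≠ k, {ω | penEmpRisk α Kpen ρ (fun i => Xs i ω) (fun i => Ys i ω) m ≤
        penEmpRisk α Kpen ρ (fun i => Xs i ω) (fun i => Ys i ω) k} := fun _ hω =>
  Set.mem_biUnion hω (penEmpRisk_mHat_le _ _ hd hn hKpen k)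

end Estimator

section Comparison

variable {d : ℕ} {Ω₀ Ω : Type*} [MeasurableSpace Ω₀] [MeasurableSpace Ω] {μ : Measure Ω₀}
  {P : Measure Ω} {X : Ω₀ → BVPath d} {Y : Ω₀ → ℝ} {KX KY α Kpen ρ gap : ℝ} {m mstar n : ℕ}
  {βstar : SigSpace d mstar} {x : Fin n → BVPath d} {y : Fin n → ℝ}

theorem exists_deviation_of_penEmpRisk_le_of_gt (hα : 0 ≤ α) (hβα : ‖βstar‖ ≤ α)
    (hrisk : ∀ β : SigSpace d m, risk μ X Y mstar βstar ≤ risk μ X Y m β) (hm : mstar < m)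
    (hle : penEmpRisk α Kpen ρ x y m ≤ penEmpRisk α Kpen ρ x y mstar) :
    ∃ β β' : SigSpace d m, ‖β‖ ≤ α ∧ ‖β'‖ ≤ α ∧
      pen d Kpen ρ n m - pen d Kpen ρ n mstar ≤
        |empRisk x y m β - empRisk x y m β' - (risk μ X Y m β - risk μ X Y m β')| := by
  obtain ⟨β, hβ, hβmin⟩ := exists_empRisk_eq_minEmpRisk x y hα m
  refine ⟨padSig hm.le βstar, β, by rwa [norm_padSig], hβ, le_trans ?_ (le_abs_self _)⟩
  rw [empRisk_padSig, risk_padSig, hβmin]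
  unfold penEmpRisk at hle
  linarith [hrisk β, minEmpRisk_le x y hβα]

theorem exists_deviation_of_penEmpRisk_le_of_lt (hα : 0 ≤ α) (hβα : ‖βstar‖ ≤ α)
    (hgap : risk μ X Y mstar βstar + gap ≤ minRisk μ X Y α (mstar - 1)) (hKpen : 0 ≤ Kpen)
    (hpen : pen d Kpen ρ n mstar ≤ gap / 2) (hm : m < mstar)
    (hle : penEmpRisk α Kpen ρ x y m ≤ penEmpRisk α Kpen ρ x y mstar) :
    ∃ β β' : SigSpace d mstar, ‖β‖ ≤ α ∧ ‖β'‖ ≤ α ∧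
      gap / 2 ≤ |empRisk x y mstar β - empRisk x y mstar β' -
        (risk μ X Y mstar β - risk μ X Y mstar β')| := by
  obtain ⟨β, hβ, hβmin⟩ := exists_empRisk_eq_minEmpRisk x y hα m
  refine ⟨βstar, padSig hm.le β, hβα, by rwa [norm_padSig], le_trans ?_ (le_abs_self _)⟩
  rw [empRisk_padSig, risk_padSig, hβmin]
  have hpen0 : 0 ≤ pen d Kpen ρ n m := pen_nonneg hKpen
  have hmin : minRisk μ X Y α (mstar - 1) ≤ risk μ X Y m β :=
    minRisk_le_risk (Nat.le_sub_one_of_lt hm) hβ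
  unfold penEmpRisk at hle
  linarith [minEmpRisk_le x y hβα]

variable [IsProbabilityMeasure μ] [IsProbabilityMeasure P] {Xs : Fin n → Ω → BVPath d}
  {Ys : Fin n → Ω → ℝ}

theorem IsBoundedPair.measureReal_penEmpRisk_le_of_gt (h : IsBoundedPair μ X Y KX KY) (hα : 0 < α)
    (hKY : 0 < KY) (hn : 0 < n)
    (hs : IsIIDSample P μ (fun i ω => (Xs i ω, Ys i ω)) fun ω => (X ω, Y ω)) (hβα : ‖βstar‖ ≤ α)
    (hrisk : ∀ β : SigSpace d m, risk μ X Y mstar βstar ≤ risk μ X Y m β) (hm : mstar < m)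
    (hpen : pen d Kpen ρ n mstar < pen d Kpen ρ n m) :
    P.real {ω | penEmpRisk α Kpen ρ (fun i => Xs i ω) (fun i => Ys i ω) m ≤
        penEmpRisk α Kpen ρ (fun i => Xs i ω) (fun i => Ys i ω) mstar} ≤
      2 * Real.exp (-(n * (pen d Kpen ρ n m - pen d Kpen ρ n mstar) ^ 2 /
        (50 * constK α KX KY ^ 2 * α ^ 2))) :=
  (measureReal_mono fun _ hω =>
    exists_deviation_of_penEmpRisk_le_of_gt hα.le hβα hrisk hm hω).trans
    (h.measureReal_exists_riskDeviation_ge_le hα hKY hn hs m (sub_pos.2 hpen))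

theorem IsBoundedPair.measureReal_penEmpRisk_le_of_lt (h : IsBoundedPair μ X Y KX KY) (hα : 0 < α)
    (hKY : 0 < KY) (hn : 0 < n)
    (hs : IsIIDSample P μ (fun i ω => (Xs i ω, Ys i ω)) fun ω => (X ω, Y ω)) (hβα : ‖βstar‖ ≤ α)
    (hgap0 : 0 < gap) (hgap : risk μ X Y mstar βstar + gap ≤ minRisk μ X Y α (mstar - 1))
    (hKpen : 0 ≤ Kpen) (hpen : pen d Kpen ρ n mstar ≤ gap / 2) (hm : m < mstar) :
    P.real {ω | penEmpRisk α Kpen ρ (fun i => Xs i ω) (fun i => Ys i ω) m ≤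
        penEmpRisk α Kpen ρ (fun i => Xs i ω) (fun i => Ys i ω) mstar} ≤
      2 * Real.exp (-(n * (gap / 2) ^ 2 / (50 * constK α KX KY ^ 2 * α ^ 2))) :=
  (measureReal_mono fun _ hω =>
    exists_deviation_of_penEmpRisk_le_of_lt hα.le hβα hgap hKpen hpen hm hω).trans
    (h.measureReal_exists_riskDeviation_ge_le hα hKY hn hs mstar (half_pos hgap0))

end Comparison

section UnionBound

variable {Ω : Type*} [MeasurableSpace Ω] {P : Measure Ω} [IsFiniteMeasure P]

theorem measureReal_iUnion_le_tsum {A : ℕ → Set Ω} {a : ℕ → ℝ} (ha : Summable a)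
    (h : ∀ j, P.real (A j) ≤ a j) : P.real (⋃ j, A j) ≤ ∑' j, a j := by
  have h0 : ∀ j, 0 ≤ a j := fun j => measureReal_nonneg.trans (h j)
  refine ENNReal.toReal_le_of_le_ofReal (tsum_nonneg h0) ?_
  rw [ENNReal.ofReal_tsum_of_nonneg h0 ha]
  refine (measure_iUnion_le _).trans (ENNReal.tsum_le_tsum fun j => ?_)
  rw [← ofReal_measureReal]
  exact ENNReal.ofReal_le_ofReal (h j)

theorem measureReal_iUnion_ne_le {A : ℕ → Set Ω} {k : ℕ} {a : ℕ → ℝ} {b : ℝ} (ha : Summable a)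
    (hgt : ∀ j, P.real (A (k + 1 + j)) ≤ a j) (hlt : ∀ m < k, P.real (A m) ≤ b) :
    P.real (⋃ m ≠ k, A m) ≤ ∑' j, a j + k * b := by
  have hsub : ⋃ m ≠ k, A m ⊆ (⋃ j, A (k + 1 + j)) ∪ ⋃ m ∈ Finset.range k, A m := by
    refine Set.iUnion₂_subset fun m hm => ?_
    rcases hm.lt_or_gt with h | h
    · exact (Set.subset_biUnion_of_mem (u := A) (Finset.mem_coe.2 (Finset.mem_range.2 h))).trans
        Set.subset_union_right
    · obtain ⟨j, rfl⟩ := Nat.exists_eq_add_of_le (Nat.succ_le_of_lt h)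
      exact (Set.subset_iUnion (fun j => A (k + 1 + j)) j).trans Set.subset_union_left
  have hhead : P.real (⋃ m ∈ Finset.range k, A m) ≤ k * b :=
    calc P.real (⋃ m ∈ Finset.range k, A m) ≤ ∑ m ∈ Finset.range k, P.real (A m) :=
          measureReal_biUnion_finset_le _ _
      _ ≤ ∑ _m ∈ Finset.range k, b := Finset.sum_le_sum fun m hm => hlt m (Finset.mem_range.1 hm)
      _ = k * b := by simp
  exact (measureReal_mono hsub).trans ((measureReal_union_le _ _).trans
    (add_le_add (measureReal_iUnion_le_tsum ha hgt) hhead))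

end UnionBound

section Constants

variable {d : ℕ} {α K KX KY Kpen ρ gap : ℝ} {m mstar n : ℕ}

theorem constK_pos (hα : 0 < α) (hKY : 0 < KY) : 0 < constK α KX KY := by
  unfold constK; positivity

theorem sigDim_pos (d m : ℕ) : (0 : ℝ) < sigDim d m :=
  one_pos.trans_le (one_le_sigDim d m)

theorem const3_pos (hd : d ≠ 0) (hKY : 0 < KY) (hKpen : 0 < Kpen) :
    0 < const3 d α K KY Kpen mstar := by
  have hs := sigDim_pos d (mstar + 1)
  unfold const3; positivity

theorem mul_div_eight_le_sq_sqrt_sub_sqrt {q s t : ℝ} (hs : 0 ≤ s) (hq : 1 / 2 ≤ q) (hq' : q ≤ 1)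
    (ht : t ≤ s * (1 - q)) : q * s / 8 ≤ (√s - √t) ^ 2 := by
  have hsqrt : √t ≤ √s * (1 - q / 2) := by
    refine Real.sqrt_le_iff.2 ⟨mul_nonneg (Real.sqrt_nonneg _) (by linarith), ?_⟩
    rw [mul_pow, Real.sq_sqrt hs]
    nlinarith [mul_nonneg hs (sq_nonneg q)]
  calc q * s / 8 ≤ (√s * q / 2) ^ 2 := by
        rw [div_pow, mul_pow, Real.sq_sqrt hs]
        nlinarith [mul_nonneg hs (by linarith : 0 ≤ q)]
    _ ≤ (√s - √t) ^ 2 := pow_le_pow_left₀ (by positivity) (by linarith) 2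

theorem mul_sigDim_div_eight_le_sq_sqrt_sub_sqrt (hd : 2 ≤ d) (hm : mstar < m) :
    (d : ℝ) ^ (mstar + 1) / sigDim d (mstar + 1) * sigDim d m / 8 ≤
      (√(sigDim d m : ℝ) - √(sigDim d mstar : ℝ)) ^ 2 := by
  have hsucc : (sigDim d (mstar + 1) : ℝ) = sigDim d mstar + (d : ℝ) ^ (mstar + 1) := by
    exact_mod_cast sigDim_succ d mstar
  have hpow : (sigDim d mstar : ℝ) ≤ (d : ℝ) ^ (mstar + 1) := by
    exact_mod_cast sigDim_le_pow hd mstar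
  have hmono : (sigDim d (mstar + 1) : ℝ) ≤ sigDim d m := Nat.cast_le.2 (sigDim_mono d hm)
  have hstar := sigDim_pos d mstar
  have hstar' := sigDim_pos d (mstar + 1)
  have hratio : (d : ℝ) ^ (mstar + 1) / sigDim d (mstar + 1) ≤ 1 := by
    rw [div_le_one hstar']; linarith
  refine mul_div_eight_le_sq_sqrt_sub_sqrt (Nat.cast_nonneg _) ?_ hratio ?_
  · rw [le_div_iff₀ hstar']; linarith
  · calc (sigDim d mstar : ℝ)
        = sigDim d (mstar + 1) * (1 - (d : ℝ) ^ (mstar + 1) / sigDim d (mstar + 1)) := by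
          field_simp; linarith
      _ ≤ _ := mul_le_mul_of_nonneg_right hmono (by linarith)

theorem natCast_mul_sq_rpow_neg (hn : 0 < n) (ρ : ℝ) :
    (n : ℝ) * ((n : ℝ) ^ (-ρ)) ^ 2 = (n : ℝ) ^ (1 - 2 * ρ) := by
  have hn' : (0 : ℝ) < n := Nat.cast_pos.2 hn
  calc (n : ℝ) * ((n : ℝ) ^ (-ρ)) ^ 2 = (n : ℝ) ^ (1 : ℝ) * (n : ℝ) ^ (-ρ * (2 : ℕ)) := by
        rw [Real.rpow_one, Real.rpow_mul_natCast hn'.le]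
    _ = (n : ℝ) ^ (1 - 2 * ρ) := by
        rw [← Real.rpow_add hn']; congr 1; push_cast; ring

theorem const3_le (hα : α ≠ 0) (hK : K ≠ 0) :
    const3 d α K KY Kpen mstar ≤
      Kpen ^ 2 * ((d : ℝ) ^ (mstar + 1) / sigDim d (mstar + 1)) / (9216 * (K ^ 2 * α ^ 2)) := by
  have hs := sigDim_pos d (mstar + 1)
  calc const3 d α K KY Kpen mstar
      ≤ Kpen ^ 2 * (d : ℝ) ^ (mstar + 1) /
          (128 * (sigDim d (mstar + 1) : ℝ) * (72 * K ^ 2 * α ^ 2)) := by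
        unfold const3; gcongr; linarith [sq_nonneg KY]
    _ = _ := by field_simp; ring

theorem const2_le (hα : α ≠ 0) (hK : K ≠ 0) :
    const2 d α K KY Kpen gap mstar ≤
      Kpen ^ 2 * ((d : ℝ) ^ (mstar + 1) / sigDim d (mstar + 1)) / (147456 * (K ^ 2 * α ^ 2)) := by
  have hs := sigDim_pos d (mstar + 1)
  calc const2 d α K KY Kpen gap mstar
      ≤ 1 / (16 * (1152 * K ^ 2 * α ^ 2)) *
          (Kpen ^ 2 * (d : ℝ) ^ (mstar + 1) / (8 * sigDim d (mstar + 1))) := by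
        unfold const2
        refine mul_le_mul_of_nonneg ?_ ?_ (by positivity) (by positivity)
        · gcongr; exact le_add_of_nonneg_right (sq_nonneg KY)
        · split_ifs
          exacts [le_rfl, min_le_left _ _]
    _ = _ := by field_simp; ring

theorem const2_le_one_div_sixteen (hKY : 0 < KY) (hgap : gap ≤ KY ^ 2) (hmstar : mstar ≠ 0) :
    const2 d α K KY Kpen gap mstar ≤ 1 / 16 := by
  have hden : KY ^ 2 ≤ 1152 * K ^ 2 * α ^ 2 + KY ^ 2 := le_add_of_nonneg_left (by positivity)
  calc const2 d α K KY Kpen gap mstar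
      ≤ 1 / (16 * (1152 * K ^ 2 * α ^ 2 + KY ^ 2)) * KY ^ 2 := by
        unfold const2
        rw [if_neg hmstar]
        gcongr
        exact (min_le_right _ _).trans hgap
    _ ≤ 1 / (16 * KY ^ 2) * KY ^ 2 := by gcongr
    _ = 1 / 16 := by field_simp

theorem const3_mul_add_const2_mul_le (hd : 2 ≤ d) (hα : 0 < α) (hK : 0 < K) (hρ : ρ < 1 / 2)
    (hn : 0 < n) (hm : mstar < m) :
    const3 d α K KY Kpen mstar * sigDim d m +
        const2 d α K KY Kpen gap mstar * (n : ℝ) ^ (1 - 2 * ρ) ≤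
      n * (pen d Kpen ρ n m - pen d Kpen ρ n mstar) ^ 2 / (50 * K ^ 2 * α ^ 2) := by
  set q := (d : ℝ) ^ (mstar + 1) / sigDim d (mstar + 1)
  set N := (n : ℝ) ^ (1 - 2 * ρ)
  have : 0 ≤ q := div_nonneg (by positivity) (sigDim_pos _ _).le
  have hN : 1 ≤ N := Real.one_le_rpow (by exact_mod_cast hn) (by linarith)
  have hs : (1 : ℝ) ≤ sigDim d m := one_le_sigDim d m
  have hpen : n * (pen d Kpen ρ n m - pen d Kpen ρ n mstar) ^ 2 =
      Kpen ^ 2 * N * (√(sigDim d m : ℝ) - √(sigDim d mstar : ℝ)) ^ 2 := by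
    rw [pen_sub_pen, show N = _ from (natCast_mul_sq_rpow_neg hn ρ).symm]; ring
  have h3 : const3 d α K KY Kpen mstar * sigDim d m ≤
      Kpen ^ 2 * q / (9216 * (K ^ 2 * α ^ 2)) * (N * sigDim d m) :=
    mul_le_mul (const3_le hα.ne' hK.ne') (le_mul_of_one_le_left (by linarith) hN) (by linarith)
      (by positivity)
  have h2 : const2 d α K KY Kpen gap mstar * N ≤
      Kpen ^ 2 * q / (147456 * (K ^ 2 * α ^ 2)) * (N * sigDim d m) :=
    mul_le_mul (const2_le hα.ne' hK.ne') (le_mul_of_one_le_right (by linarith) hs) (by linarith)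
      (by positivity)
  calc _ ≤ Kpen ^ 2 * q / (9216 * (K ^ 2 * α ^ 2)) * (N * sigDim d m) +
        Kpen ^ 2 * q / (147456 * (K ^ 2 * α ^ 2)) * (N * sigDim d m) := add_le_add h3 h2
    _ = 17 / 147456 * (Kpen ^ 2 * q / (K ^ 2 * α ^ 2) * (N * sigDim d m)) := by
      field_simp; ring
    _ ≤ 1 / 400 * (Kpen ^ 2 * q / (K ^ 2 * α ^ 2) * (N * sigDim d m)) := by
      exact mul_le_mul_of_nonneg_right (by norm_num) (by positivity)
    _ = Kpen ^ 2 * N * (q * sigDim d m / 8) / (50 * K ^ 2 * α ^ 2) := by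
      field_simp; ring
    _ ≤ _ := by
      rw [hpen]
      gcongr
      exact mul_sigDim_div_eight_le_sq_sqrt_sub_sqrt hd hm

theorem mul_two_sqrt_sigDim_le_of_sampleThreshold_le (hα : 0 ≤ α) (hK : 0 ≤ K) (hKpen : 0 ≤ Kpen)
    (hgap : 0 < gap) (hn : 0 < n) (hmstar : mstar ≠ 0)
    (hthr : sampleThreshold d α K Kpen gap mstar ≤ (n : ℝ) ^ min ρ (1 / 2 - ρ)) :
    (432 * K * α * √Real.pi + Kpen) * (2 * √(sigDim d (mstar + 1) : ℝ)) ≤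
      (n : ℝ) ^ ρ * gap := by
  rw [← div_le_iff₀ hgap, mul_div_assoc]
  calc (432 * K * α * √Real.pi + Kpen) * (2 * √(sigDim d (mstar + 1) : ℝ) / gap)
      ≤ sampleThreshold d α K Kpen gap mstar := by
        unfold sampleThreshold
        rw [if_neg hmstar]
        gcongr
        exact le_add_of_nonneg_right (by positivity)
    _ ≤ (n : ℝ) ^ min ρ (1 / 2 - ρ) := hthr
    _ ≤ (n : ℝ) ^ ρ :=
        Real.rpow_le_rpow_of_exponent_le (by exact_mod_cast hn) (min_le_left _ _)

theorem pen_le_half_gap (hα : 0 ≤ α) (hK : 0 ≤ K) (hKpen : 0 ≤ Kpen) (hgap : 0 < gap) (hn : 0 < n)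
    (hmstar : mstar ≠ 0)
    (hthr : sampleThreshold d α K Kpen gap mstar ≤ (n : ℝ) ^ min ρ (1 / 2 - ρ)) :
    pen d Kpen ρ n mstar ≤ gap / 2 := by
  have : 0 < (n : ℝ) ^ ρ := Real.rpow_pos_of_pos (Nat.cast_pos.2 hn) ρ
  have hsqrt : Kpen * √(sigDim d mstar : ℝ) ≤ (n : ℝ) ^ ρ * gap / 2 := by
    calc Kpen * √(sigDim d mstar : ℝ)
        ≤ (432 * K * α * √Real.pi + Kpen) * √(sigDim d (mstar + 1) : ℝ) := by
          gcongr
          · exact le_add_of_nonneg_left (by positivity)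
          · exact sigDim_mono d (Nat.le_succ mstar)
      _ ≤ (n : ℝ) ^ ρ * gap / 2 := by
          linarith [mul_two_sqrt_sigDim_le_of_sampleThreshold_le hα hK hKpen hgap hn hmstar hthr]
  calc pen d Kpen ρ n mstar = ((n : ℝ) ^ ρ)⁻¹ * (Kpen * √(sigDim d mstar : ℝ)) := by
        rw [pen, Real.rpow_neg (Nat.cast_nonneg n)]; ring
    _ ≤ ((n : ℝ) ^ ρ)⁻¹ * ((n : ℝ) ^ ρ * gap / 2) := by gcongr
    _ = gap / 2 := by field_simp

theorem const2_mul_le (hα : 0 < α) (hK : 0 < K) (hKY : 0 < KY) (hKpen : 0 ≤ Kpen)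
    (hgap : 0 < gap) (hgapY : gap ≤ KY ^ 2) (hn : 0 < n) (hmstar : mstar ≠ 0)
    (hthr : sampleThreshold d α K Kpen gap mstar ≤ (n : ℝ) ^ min ρ (1 / 2 - ρ)) :
    const2 d α K KY Kpen gap mstar * (n : ℝ) ^ (1 - 2 * ρ) ≤
      n * (gap / 2) ^ 2 / (50 * K ^ 2 * α ^ 2) := by
  have : 0 < (n : ℝ) ^ ρ := Real.rpow_pos_of_pos (Nat.cast_pos.2 hn) ρ
  have hbig : 864 * (K * α) ≤ (n : ℝ) ^ ρ * gap := by
    calc 864 * (K * α) = 432 * K * α * 1 * (2 * 1) := by ring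
      _ ≤ (432 * K * α * √Real.pi + Kpen) * (2 * √(sigDim d (mstar + 1) : ℝ)) := by
          gcongr
          · refine le_add_of_le_of_nonneg ?_ hKpen
            gcongr
            exact Real.one_le_sqrt.2 (by linarith [Real.pi_gt_three])
          · exact Real.one_le_sqrt.2 (one_le_sigDim d (mstar + 1))
      _ ≤ _ := mul_two_sqrt_sigDim_le_of_sampleThreshold_le hα.le hK.le hKpen hgap hn hmstar hthr
  have hratio : 1 / 16 ≤ ((n : ℝ) ^ ρ * gap) ^ 2 / (200 * (K * α) ^ 2) := by
    rw [div_le_div_iff₀ (by norm_num) (by positivity)]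
    nlinarith [pow_le_pow_left₀ (by positivity) hbig 2, mul_pos hK hα]
  calc const2 d α K KY Kpen gap mstar * (n : ℝ) ^ (1 - 2 * ρ)
      ≤ ((n : ℝ) ^ ρ * gap) ^ 2 / (200 * (K * α) ^ 2) * (n : ℝ) ^ (1 - 2 * ρ) := by
        gcongr
        exact (const2_le_one_div_sixteen hKY hgapY hmstar).trans hratio
    _ = n * (gap / 2) ^ 2 / (50 * K ^ 2 * α ^ 2) := by
        rw [← natCast_mul_sq_rpow_neg hn, Real.rpow_neg (Nat.cast_nonneg n)]
        field_simp; ring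

theorem pos_of_sampleThreshold_le (hd : d ≠ 0) (hα : 0 ≤ α) (hK : 0 ≤ K) (hKpen : 0 < Kpen)
    (hgap : mstar ≠ 0 → 0 ≤ gap) (hρ : 0 < ρ) (hρ' : ρ < 1 / 2)
    (hthr : sampleThreshold d α K Kpen gap mstar ≤ (n : ℝ) ^ min ρ (1 / 2 - ρ)) : 0 < n := by
  have hs := sigDim_pos d (mstar + 1)
  have hpos : 0 < sampleThreshold d α K Kpen gap mstar := by
    refine mul_pos (by positivity) (add_pos_of_nonneg_of_pos ?_ (by positivity))
    split_ifs with hmstar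
    · exact le_rfl
    · exact div_nonneg (by positivity) (hgap hmstar)
  refine Nat.pos_of_ne_zero fun hn => (hpos.trans_le hthr).ne' ?_
  rw [hn, Nat.cast_zero, Real.zero_rpow (lt_min hρ (by linarith)).ne']

theorem tsum_add_mul_le_const1_mul {E : ℝ} (hE : 0 ≤ E) :
    ∑' j : ℕ, 2 * Real.exp (-const3 d α K KY Kpen mstar * (sigDim d (j + 1) : ℝ)) * E +
        mstar * (2 * E) ≤ const1 d α K KY Kpen mstar * E := by
  have hsum : 0 ≤ ∑' j : ℕ, Real.exp (-const3 d α K KY Kpen mstar * (sigDim d (j + 1) : ℝ)) :=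
    tsum_nonneg fun _ => (Real.exp_pos _).le
  rw [tsum_mul_right, tsum_mul_left, const1]
  nlinarith [mul_nonneg hsum hE, mul_nonneg (Nat.cast_nonneg (α := ℝ) mstar) hE]

end Constants

section OrderSelection

variable {d : ℕ} {Ω₀ Ω : Type*} [MeasurableSpace Ω₀] [MeasurableSpace Ω] {μ : Measure Ω₀}
  [IsProbabilityMeasure μ] {P : Measure Ω} [IsProbabilityMeasure P] {X : Ω₀ → BVPath d}
  {Y : Ω₀ → ℝ} {KX KY α Kpen ρ gap : ℝ} {mstar n : ℕ} {βstar : SigSpace d mstar}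
  {Xs : Fin n → Ω → BVPath d} {Ys : Fin n → Ω → ℝ}

theorem IsBoundedPair.measureReal_penEmpRisk_add_le_exp (h : IsBoundedPair μ X Y KX KY)
    (hd : 2 ≤ d) (hα : 0 < α) (hKY : 0 < KY) (hKpen : 0 < Kpen) (hρ : ρ < 1 / 2) (hn : 0 < n)
    (hs : IsIIDSample P μ (fun i ω => (Xs i ω, Ys i ω)) fun ω => (X ω, Y ω)) (hβα : ‖βstar‖ ≤ α)
    {j : ℕ} (hrisk : ∀ β : SigSpace d (mstar + 1 + j),
      risk μ X Y mstar βstar ≤ risk μ X Y (mstar + 1 + j) β) :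
    P.real {ω | penEmpRisk α Kpen ρ (fun i => Xs i ω) (fun i => Ys i ω) (mstar + 1 + j) ≤
        penEmpRisk α Kpen ρ (fun i => Xs i ω) (fun i => Ys i ω) mstar} ≤
      2 * Real.exp (-const3 d α (constK α KX KY) KY Kpen mstar * (sigDim d (j + 1) : ℝ)) *
        Real.exp (-const2 d α (constK α KX KY) KY Kpen gap mstar * (n : ℝ) ^ (1 - 2 * ρ)) := by
  have hd0 : d ≠ 0 := by omega
  have hm : mstar < mstar + 1 + j := by omega
  have hexp := const3_mul_add_const2_mul_le (KY := KY) (Kpen := Kpen) (gap := gap) hd hα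
    (constK_pos (KX := KX) hα hKY) hρ hn hm
  refine (h.measureReal_penEmpRisk_le_of_gt hα hKY hn hs hβα hrisk hm
    (pen_lt_pen hd0 hKpen hn hm)).trans ?_
  calc _ ≤ 2 * (Real.exp (-const3 d α (constK α KX KY) KY Kpen mstar *
          (sigDim d (mstar + 1 + j) : ℝ)) *
        Real.exp (-const2 d α (constK α KX KY) KY Kpen gap mstar * (n : ℝ) ^ (1 - 2 * ρ))) := by
        rw [← Real.exp_add]
        exact mul_le_mul_of_nonneg_left (Real.exp_le_exp.2 (by linarith)) zero_le_two
    _ ≤ _ := by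
        rw [← mul_assoc]
        gcongr ?_ * ?_ * _
        exact exp_neg_mul_sigDim_add_le (const3_pos hd0 hKY hKpen) mstar j

theorem IsBoundedPair.measureReal_penEmpRisk_le_exp (h : IsBoundedPair μ X Y KX KY) (hα : 0 < α)
    (hKY : 0 < KY) (hKpen : 0 ≤ Kpen) (hn : 0 < n)
    (hs : IsIIDSample P μ (fun i ω => (Xs i ω, Ys i ω)) fun ω => (X ω, Y ω)) (hβα : ‖βstar‖ ≤ α)
    (hgap0 : 0 < gap) (hgapY : gap ≤ KY ^ 2)
    (hgap : risk μ X Y mstar βstar + gap ≤ minRisk μ X Y α (mstar - 1))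
    (hthr : sampleThreshold d α (constK α KX KY) Kpen gap mstar ≤ (n : ℝ) ^ min ρ (1 / 2 - ρ))
    {m : ℕ} (hm : m < mstar) :
    P.real {ω | penEmpRisk α Kpen ρ (fun i => Xs i ω) (fun i => Ys i ω) m ≤
        penEmpRisk α Kpen ρ (fun i => Xs i ω) (fun i => Ys i ω) mstar} ≤
      2 * Real.exp (-const2 d α (constK α KX KY) KY Kpen gap mstar * (n : ℝ) ^ (1 - 2 * ρ)) := by
  have hK : 0 < constK α KX KY := constK_pos hα hKY
  have hmstar : mstar ≠ 0 := Nat.ne_zero_of_lt hm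
  refine (h.measureReal_penEmpRisk_le_of_lt hα hKY hn hs hβα hgap0 hgap hKpen
    (pen_le_half_gap hα.le hK.le hKpen hgap0 hn hmstar hthr) hm).trans ?_
  gcongr
  linarith [const2_mul_le hα hK hKY hKpen hgap0 hgapY hn hmstar hthr]

end OrderSelection

end SignatureRegression

theorem theorem1_general {Ω₀ : Type*} [MeasurableSpace Ω₀] {μ : Measure Ω₀}
    [IsProbabilityMeasure μ] {d : ℕ} (hd : 2 ≤ d) {X : Ω₀ → BVPath d} {Y : Ω₀ → ℝ} {KX KY : ℝ}
    (h : IsBoundedPair μ X Y KX KY) (hKY : 0 < KY) {α : ℝ} (hα : 0 < α) {mstar : ℕ}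
    {βstar : SigSpace d mstar} (hβα : ‖βstar‖ ≤ α)
    (hrisk : ∀ m > mstar, ∀ β : SigSpace d m, risk μ X Y mstar βstar ≤ risk μ X Y m β)
    {v : ℝ} (hv : risk μ X Y mstar βstar ≤ v) (hgap : mstar ≠ 0 → v < minRisk μ X Y α (mstar - 1))
    {Kpen ρ : ℝ} (hKpen : 0 < Kpen) (hρ : 0 < ρ) (hρ' : ρ < 1 / 2) {n : ℕ}
    (hthr : sampleThreshold d α (constK α KX KY) Kpen (minRisk μ X Y α (mstar - 1) - v) mstar
      ≤ (n : ℝ) ^ min ρ (1 / 2 - ρ))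
    {Ω : Type*} [MeasurableSpace Ω] {P : Measure Ω} [IsProbabilityMeasure P]
    {Xs : Fin n → Ω → BVPath d} {Ys : Fin n → Ω → ℝ}
    (hs : IsIIDSample P μ (fun i ω => (Xs i ω, Ys i ω)) fun ω => (X ω, Y ω)) :
    Summable (fun m : ℕ => Real.exp (-const3 d α (constK α KX KY) KY Kpen mstar *
      (sigDim d (m + 1) : ℝ))) ∧
    P.real {ω | mHat α Kpen ρ (fun i => Xs i ω) (fun i => Ys i ω) ≠ mstar} ≤
      const1 d α (constK α KX KY) KY Kpen mstar *
        Real.exp (-const2 d α (constK α KX KY) KY Kpen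
          (minRisk μ X Y α (mstar - 1) - v) mstar * (n : ℝ) ^ (1 - 2 * ρ)) := by
  set gap := minRisk μ X Y α (mstar - 1) - v
  have hd0 : d ≠ 0 := by omega
  have hgap0 (h0 : mstar ≠ 0) : 0 < gap := sub_pos.2 (hgap h0)
  have hgapY : gap ≤ KY ^ 2 := (sub_le_self _ ((risk_nonneg _ _).trans hv)).trans
    (minRisk_le_sq hα.le h.abs_response_le _)
  have hn : 0 < n := pos_of_sampleThreshold_le hd0 hα.le (constK_pos hα hKY).le hKpen
    (fun h0 => (hgap0 h0).le) hρ hρ' hthr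
  have hsummable := summable_exp_neg_mul_sigDim_succ hd0
    (const3_pos (α := α) (K := constK α KX KY) (mstar := mstar) hd0 hKY hKpen)
  have hgt (j : ℕ) := h.measureReal_penEmpRisk_add_le_exp (gap := gap) hd hα hKY hKpen hρ' hn hs
    hβα (hrisk (mstar + 1 + j) (by omega))
  have hlt (m : ℕ) (hm : m < mstar) := h.measureReal_penEmpRisk_le_exp hα hKY hKpen.le hn hs hβα
    (hgap0 (Nat.ne_zero_of_lt hm)) hgapY (by linarith) hthr hm
  have hunion := measureReal_iUnion_ne_le ((hsummable.mul_left 2).mul_right _) hgt hlt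
  exact ⟨hsummable,
    (measureReal_mono (setOf_mHat_ne_subset Xs Ys hd0 hn hKpen mstar) (measure_ne_top P _)).trans
      (hunion.trans (tsum_add_mul_le_const1_mul (Real.exp_pos _).le))⟩

theorem theorem1
    -- the law of the random couple `(X, Y)`
    {Ω₀ : Type*} [MeasurableSpace Ω₀] (μ : Measure Ω₀) [IsProbabilityMeasure μ]
    (d : ℕ) (hd : 2 ≤ d) (X : Ω₀ → BVPath d) (hX : Measurable X) (Y : Ω₀ → ℝ) (hY : Measurable Y)
    -- the signature linear model, with smallest truncation order `mstar`
    (mstar : ℕ)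
    (hmstar : IsLeast {m : ℕ | ∃ β : SigSpace d m,
      μ[Y | MeasurableSpace.comap X inferInstance] =ᵐ[μ] fun ω => inner ℝ β (truncSig m (X ω))}
      mstar)
    (σ : ℝ) (hσ : ∀ᵐ ω ∂μ, Var[Y; μ | MeasurableSpace.comap X inferInstance] ω ≤ σ ^ 2)
    -- the true coefficient lies in the ball of radius `α`
    (α : ℝ) (hα : 0 < α) (βstar : SigSpace d mstar)
    (hβstar : μ[Y | MeasurableSpace.comap X inferInstance] =ᵐ[μ]
      fun ω => inner ℝ βstar (truncSig mstar (X ω)))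
    (hβα : ‖βstar‖ ≤ α)
    -- almost sure bounds on `Y` and on the total variation of `X`
    (KX KY : ℝ) (hKX : 0 < KX) (hKY : 0 < KY)
    (hYb : ∀ᵐ ω ∂μ, |Y ω| ≤ KY) (hXb : ∀ᵐ ω ∂μ, totalVariation (X ω) ≤ KX)
    -- `L(mstar - 1) - σ²` is positive (no condition when `mstar = 0`)
    (hgap : mstar ≠ 0 → σ ^ 2 < minRisk μ X Y α (mstar - 1))
    -- the penalty
    (Kpen ρ : ℝ) (hKpen : 0 < Kpen) (hρ : 0 < ρ) (hρ' : ρ < 1 / 2)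
    -- the sample size
    (n₀ : ℕ)
    (hn₀ : IsLeast {N : ℕ |
      sampleThreshold d α (constK α KX KY) Kpen (minRisk μ X Y α (mstar - 1) - σ ^ 2) mstar
        ≤ (N : ℝ) ^ min ρ (1 / 2 - ρ)} n₀)
    (n : ℕ) (hn : n₀ ≤ n)
    -- an i.i.d. sample of size `n` of the law of `(X, Y)`
    {Ω : Type*} [MeasurableSpace Ω] (P : Measure Ω) [IsProbabilityMeasure P]
    (Xs : Fin n → Ω → BVPath d) (Ys : Fin n → Ω → ℝ)
    (hindep : iIndepFun (fun i ω => (Xs i ω, Ys i ω)) P)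
    (hident : ∀ i, IdentDistrib (fun ω => (Xs i ω, Ys i ω)) (fun ω => (X ω, Y ω)) P μ) :
    -- the series in `C₁` converges
    Summable (fun m : ℕ => Real.exp (-const3 d α (constK α KX KY) KY Kpen mstar *
      (sigDim d (m + 1) : ℝ))) ∧
    P.real {ω | mHat α Kpen ρ (fun i => Xs i ω) (fun i => Ys i ω) ≠ mstar} ≤
      const1 d α (constK α KX KY) KY Kpen mstar *
        Real.exp (-const2 d α (constK α KX KY) KY Kpen
          (minRisk μ X Y α (mstar - 1) - σ ^ 2) mstar * (n : ℝ) ^ (1 - 2 * ρ)) := by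
  have h : IsBoundedPair μ X Y KX KY := ⟨hX, hY, hXb, hYb⟩
  exact theorem1_general hd h hKY hα hβα (fun _ _ β => h.risk_le_risk_of_condExp hβstar β)
    (h.risk_le_of_condVar_le hβstar hσ) hgap hKpen hρ hρ' (hn₀.1.trans (Real.rpow_le_rpow
      (Nat.cast_nonneg _) (Nat.cast_le.2 hn) (le_min hρ.le (by linarith)))) ⟨hindep, hident⟩
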